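/- **Proposition.** For $n\ge 0$ and $m\ge 1$ let $$f(s,t)=s_0\wedge\dots\wedge s_{n-1}\wedge\bigl(t_0\wedge(t_1\vee(t_2\wedge(t_3\vee\cdots)))\bigr)$$ be the extended And-Or path on symmetric inputs $s=(s_0,\dots,s_{n-1})$ and alternating inputs $t=(t_0,\dots,t_{m-1})$, and let $f^*$ be its dual (exchange $\wedge$ and $\vee$). Fix a rational constant $\xi\in[1.9,2)$, put $\mu(d,n)=\xi\,\frac{2^d-n-2}{d}+2$, and let $d_{\min}(n,m)$ be the least $d\ge1$ with $m\le\mu(d,n)$. A *leftist circuit* on $x_0,\dots,x_{r-1}$ for $\circ\in\{\wedge,\vee\}$ is obtained by repeatedly splitting off, from the left, the largest possible power of two of the remaining inputs and building an ordered full binary tree of $\circ$-gates on them. The *boundary sequence* of a set $K$ of its inputs lists from left to right the maximal subtrees whose inputs all lie in $K$. The *symmetric tree* for $K$ and a constant number of further vertices is built by Huffman coding (repeatedly join two vertices with smallest arrival times) on the roots of the boundary sequence, with their depths as arrival times, and on the further vertices. The algorithm constructs a leftist And-circuit $S_0$ on $s_0,\dots,s_{n-1},t_0,t_2,t_4,\dots$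 and a leftist Or-circuit $S_1$ on $t_1,t_3,t_5,\dots$; for each of them it tabulates, for every input, the vertices (by depth) that have this input as left-most input, the highest such depth, and, for every vertex, its right-most input. It then calls the following recursion on $(s,t)$. The recursion is stated for computing $f(s,t)$ with current sizes $n,m$, symmetric trees being taken in $S_0$; the dual calls $f^*$ exchange And and Or and use $S_1$. 1. If $m\le 2$: symmetric tree on all inputs. Otherwise let $d=d_{\min}(n,m)$. 2. If $d\le 3$ (so $m\le5$): symmetric tree on $s$, $t_0$ and the vertices $t_1\vee t_2$ (if $m=3$), or $t_1\vee(t_2\wedge t_3)$ (if $m=4$), or $t_1\vee t_2$ and $t_1\vee(t_3\vee t_4)$ (if $m=5$). 3. If $n\ge2^{d-1}$: take $s'\subseteq s$ to be the inputs of a tree of depth $d-1$ in the boundary sequence of $s$ if there is one, and otherwise the inputs of all trees from the first to the second of two trees of equal depth, this depth being as large as possible; return $\mathrm{sym}(s')\wedge f(s\setminus s',t)$. 4. Otherwise, if $m\le\mu(d-1,0)$: return $\mathrm{sym}(s)\wedge f((),t)$. 5. Otherwise let $k$ be the largest odd integer with $k\le\mu(d-1,n)$; return $f\bigl(s,(t_0,\dots,t_{k-1})\bigr)\wedge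 f^*\bigl((t_1,t_3,\dots,t_{k-2}),(t_k,\dots,t_{m-1})\bigr)$. There is an implementation of this algorithm, given explicitly as a program for a random access machine with unit-cost arithmetic, comparisons and array accesses, and a constant $C>0$ (depending only on $\xi$), such that for all $n\ge0$, $m\ge1$ with $\max\{n,m\}\ge2$ the program terminates on $n$ symmetric and $m$ alternating inputs after at most $$C\,(m+n)\,(\log_2 n+\log_2 m)$$ steps, where $\log_2 0$ is read as $0$. -/

import Mathlib

/-!
# The leftist-circuit algorithm for extended And-Or paths on a unit-cost random access machine

The extended And-Or path on symmetric inputs `s₀, …, s_{n-1}` and alternating inputs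
`t₀, …, t_{m-1}` is `f (s, t) = s₀ ∧ ⋯ ∧ s_{n-1} ∧ (t₀ ∧ (t₁ ∨ (t₂ ∧ (t₃ ∨ ⋯))))`; its dual `f*`
arises by exchanging `∧` and `∨`.  This file contains the algorithm which builds a circuit
for `f (s, t)`, written as a program whose elementary operations are counted.
-/

namespace AndOr

/-! ## Circuits -/

/-- A gate: its type (`true` for And, `false` for Or) and its two predecessors.  Vertices of a
circuit are numbered: first the `n + m` inputs `s₀, …, s_{n-1}, t₀, …, t_{m-1}`, then the gates
in the order of their construction. -/
structure Gate where
  isAnd : Bool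
  left : ℕ
  right : ℕ

/-! ## The machine: unit-cost random access machine with a step counter

A program is a sequence of the elementary operations below.  Every one of them works on a constant
number of machine words and costs one step (reserving an array costs one step per cell).
Besides them, programs only use the control structures of the language (sequencing, branching on
an already computed Boolean, recursive calls, passing a constant number of words and
references).  Arrays and trees are passed by reference, and an array is never used again
after it has been modified, so that modifying it in place is sound.  -/

/-- The machine state: number of inputs, gates built so far, steps done so far. -/
structure State where
  inputs : ℕ
  gates : Array Gate
  time : ℕ

/-- Programs with result in `α`.  The outcome `none` stands for an illegal memory access or for
a computation that does not terminate. -/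
abbrev RAM (α : Type) : Type := StateT State Option α

/-- One elementary operation with result `a`. -/
def prim {α : Type} (a : α) : RAM α := fun σ => some (a, { σ with time := σ.time + 1 })

/-- An illegal memory access. -/
def crash {α : Type} : RAM α := fun _ => none

/-! Arithmetic and comparisons on natural numbers; subtraction is truncated, division rounds
down. -/
def add (x y : ℕ) : RAM ℕ := prim (x + y)
def sub (x y : ℕ) : RAM ℕ := prim (x - y)
def mul (x y : ℕ) : RAM ℕ := prim (x * y)
def quo (x y : ℕ) : RAM ℕ := prim (x / y)
def le (x y : ℕ) : RAM Bool := prim (decide (x ≤ y))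
def lt (x y : ℕ) : RAM Bool := prim (decide (x < y))
def eq (x y : ℕ) : RAM Bool := prim (decide (x = y))

/-! Arrays with constant-time access. -/
def length {α : Type} (a : Array α) : RAM ℕ := prim a.size
def read {α : Type} (a : Array α) (i : ℕ) : RAM α :=
  match a[i]? with
  | some v => prim v
  | none => crash
def write {α : Type} (a : Array α) (i : ℕ) (v : α) : RAM (Array α) :=
  if i < a.size then prim (a.setIfInBounds i v) else crash
/-- Append a cell to an array (dynamic array: unit amortized cost). -/
def push {α : Type} (a : Array α) (v : α) : RAM (Array α) := prim (a.push v)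
/-- Reserve and fill an array of length `k`, at a cost of `k + 1` steps; if `v` is an empty array,
then every cell gets an empty array of its own. -/
def newArray {α : Type} (k : ℕ) (v : α) : RAM (Array α) := fun σ =>
  some (Array.replicate k v, { σ with time := σ.time + (k + 1) })

/-- Add a gate with predecessors `u`, `v` to the circuit; the result is the new vertex. -/
def newGate (isAnd : Bool) (u v : ℕ) : RAM ℕ := fun σ =>
  some (σ.inputs + σ.gates.size,
    { σ with gates := σ.gates.push ⟨isAnd, u, v⟩, time := σ.time + 1 })

/-! ## Leftist circuits -/

/-- An ordered binary tree in the circuit: `leaf i v` is the input at position `i`, which is the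
vertex `v`; `node v T T'` is the gate `v` with left subtree `T` and right subtree `T'`. -/
inductive Tree where
  | leaf (i v : ℕ) : Tree
  | node (v : ℕ) (T T' : Tree) : Tree

/-- The root vertex of a tree. -/
def root : Tree → RAM ℕ
  | .leaf _ v => prim v
  | .node v _ _ => prim v

/-- Build the ordered full symmetric tree of depth `k` on the `2 ^ k` inputs at positions
`i, i + 1, …`; the result is the tree and the position following its last input. -/
def buildTree (isAnd : Bool) (ins : Array ℕ) : ℕ → ℕ → RAM (Tree × ℕ)
  | 0, i => do
    let v ← read ins i
    let i' ← add i 1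
    return (.leaf i v, i')
  | k + 1, i => do
    let (T, i₁) ← buildTree isAnd ins k i
    let (T', i₂) ← buildTree isAnd ins k i₁
    let v ← newGate isAnd (← root T) (← root T')
    return (.node v T T', i₂)

/-- Table of `⌊log₂ i⌋` for `1 ≤ i ≤ N`: the array `lg` has been filled up to `i - 1`. -/
def logTable (N i : ℕ) (lg : Array ℕ) : RAM (Array ℕ) := do
  if ← le i N then
    let lg' ← push lg (← add (← read lg (← quo i 2)) 1)
    logTable N (← add i 1) lg'
  else
    return lg
  partial_fixpoint

/-- Leftist circuit construction.  The `r` inputs from position `i` on are not yet treated: split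
off the largest power of two and build a full tree on it.  A single last input is a tree of
depth `0`. -/
def leftist (isAnd : Bool) (lg ins : Array ℕ) (i r : ℕ) (S : Array Tree) : RAM (Array Tree) := do
  if ← le 1 r then
    let k ← read lg r
    let (T, i') ← buildTree isAnd ins k i
    let r' ← sub r (← sub i' i)
    leftist isAnd lg ins i' r' (← push S T)
  else
    return S
  partial_fixpoint

/-- The precomputed data of a leftist circuit on the inputs `x₀, x₁, …`. -/
structure LeftistData where
  /-- `desc[i][j]` is the right descendant `s_j(x_i)` of `x_i` of depth `j`, that is, the vertex
  of depth `j` whose left-most input is `x_i`. -/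
  desc : Array (Array ℕ)
  /-- `top[i]` is the highest depth of a right descendant of `x_i`. -/
  top : Array ℕ
  /-- `right[v]` is the position of the right-most input below the vertex `v`. -/
  right : Array ℕ

/-- Enter the vertex `v` of depth `j` with left-most input `a` and right-most input `b`. -/
def enter (D : LeftistData) (v j a b : ℕ) : RAM LeftistData := do
  let row ← push (← read D.desc a) v
  let desc ← write D.desc a row
  let top ← write D.top a j
  let right ← write D.right v b
  return ⟨desc, top, right⟩

/-- Enter all vertices of a tree.  The result consists of the data and of depth, left-most and
right-most input of the root. -/
def enterTree : Tree → LeftistData → RAM (LeftistData × ℕ × ℕ × ℕ)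
  | .leaf i v, D => do
    let D' ← enter D v 0 i i
    return (D', 0, i, i)
  | .node v T T', D => do
    let (D₁, j, a, _) ← enterTree T D
    let (D₂, _, _, b) ← enterTree T' D₁
    let j' ← add j 1
    let D₃ ← enter D₂ v j' a b
    return (D₃, j', a, b)

/-- Enter all trees of a leftist circuit from the `i`-th one on. -/
def enterForest (S : Array Tree) (i : ℕ) (D : LeftistData) : RAM LeftistData := do
  if ← lt i (← length S) then
    let (D', _) ← enterTree (← read S i) D
    enterForest S (← add i 1) D'
  else
    return D
  partial_fixpoint

/-- Precomputation for a leftist circuit `S` on `r` inputs, where the whole circuit has `V`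
vertices so far. -/
def precompute (S : Array Tree) (r V : ℕ) : RAM LeftistData := do
  let desc ← newArray r #[]
  let top ← newArray r 0
  let right ← newArray V 0
  enterForest S 0 ⟨desc, top, right⟩

/-! ## Boundary vertices

The symmetric inputs of a recursive call are the inputs of a leftist circuit at the positions in
`[a, b) ∪ [c, e)` with `a ≤ b ≤ c ≤ e`. -/

/-- A set `[a, b) ∪ [c, e)` of positions. -/
structure Block where
  a : ℕ
  b : ℕ
  c : ℕ
  e : ℕ

/-- The number of elements. -/
def blockSize (K : Block) : RAM ℕ := do
  add (← sub K.b K.a) (← sub K.e K.c)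

/-- A boundary vertex with its depth and its left-most and right-most input. -/
structure Bdry where
  vertex : ℕ
  depth : ℕ
  left : ℕ
  right : ℕ

/-- Boundary vertices of the consecutive set `[i, b)` of positions, from left to right, appended
to `B`: the maximum `j` for which `s_j(x_i)` exists and only depends on inputs at positions
smaller than `b` is `min ⌊log₂ (b - i)⌋ (top i)`. -/
def intervalBdry (D : LeftistData) (lg : Array ℕ) (b i : ℕ) (B : Array Bdry) :
    RAM (Array Bdry) := do
  if ← lt i b then
    let x ← read lg (← sub b i)
    let y ← read D.top i
    let j ← if ← le x y then pure x else pure y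
    let v ← read (← read D.desc i) j
    let r ← read D.right v
    intervalBdry D lg b (← add r 1) (← push B ⟨v, j, i, r⟩)
  else
    return B
  partial_fixpoint

/-- The boundary vertices of a block, from left to right. -/
def bdry (D : LeftistData) (lg : Array ℕ) (K : Block) : RAM (Array Bdry) := do
  let B ← newArray 0 ⟨0, 0, 0, 0⟩
  intervalBdry D lg K.e K.c (← intervalBdry D lg K.b K.a B)

/-! ## Symmetric trees by Huffman coding -/

/-- A vertex with an arrival time. -/
structure Item where
  vertex : ℕ
  arrival : ℕ

/-- Sort the part `B[i], …, B[j-1]` of a boundary sequence by increasing depth, where the depths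
first increase and then decrease: repeatedly take the smaller one of the two ends. -/
def sortBdry (B : Array Bdry) (i j : ℕ) (Q : Array Item) : RAM (Array Item) := do
  if ← lt i j then
    let j' ← sub j 1
    let u ← read B i
    let v ← read B j'
    if ← le u.depth v.depth then
      sortBdry B (← add i 1) j (← push Q ⟨u.vertex, u.depth⟩)
    else
      sortBdry B i j' (← push Q ⟨v.vertex, v.depth⟩)
  else
    return Q
  partial_fixpoint

/-- Take an item with the smallest arrival time from the two queues `P[i], P[i+1], …` and
`Q[j], Q[j+1], …`, both sorted by increasing arrival time.  The result is the item and the new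
heads of the queues. -/
def popMin (P : Array Item) (i : ℕ) (Q : Array Item) (j : ℕ) : RAM (Item × ℕ × ℕ) := do
  if ← lt i (← length P) then
    let u ← read P i
    if ← lt j (← length Q) then
      let v ← read Q j
      if ← le u.arrival v.arrival then
        return (u, ← add i 1, j)
      else
        return (v, i, ← add j 1)
    else
      return (u, ← add i 1, j)
  else
    let v ← read Q j
    return (v, i, ← add j 1)

/-- Merge two sorted arrays of items (from positions `i` and `j` on). -/
def merge (P : Array Item) (i : ℕ) (Q : Array Item) (j : ℕ) (R : Array Item) :
    RAM (Array Item) := do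
  let p ← lt i (← length P)
  let q ← lt j (← length Q)
  if p || q then
    let (u, i', j') ← popMin P i Q j
    merge P i' Q j' (← push R u)
  else
    return R
  partial_fixpoint

/-- Huffman coding in linear time: `P` from `i` on contains the remaining original items,
`Q` from `j` on the remaining combined ones, both sorted by arrival time.  Repeatedly combine
two items with smallest arrival times.  The result is the root of the symmetric tree. -/
def huffman (isAnd : Bool) (P : Array Item) (i : ℕ) (Q : Array Item) (j : ℕ) : RAM ℕ := do
  let (u, i₁, j₁) ← popMin P i Q j
  let p ← lt i₁ (← length P)
  let q ← lt j₁ (← length Q)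
  if p || q then
    let (v, i₂, j₂) ← popMin P i₁ Q j₁
    let g ← newGate isAnd u.vertex v.vertex
    let t ← if ← le u.arrival v.arrival then pure v.arrival else pure u.arrival
    let Q' ← push Q ⟨g, ← add t 1⟩
    huffman isAnd P i₂ Q' j₂
  else
    return u.vertex
  partial_fixpoint

/-- Symmetric tree on the inputs below the boundary vertices `B[i], …, B[j-1]` and on the items
in `L`, which are sorted by arrival time, reusing the gates below the boundary vertices. -/
def symTree (isAnd : Bool) (B : Array Bdry) (i j : ℕ) (L : Array Item) : RAM ℕ := do
  let P ← sortBdry B i j (← newArray 0 ⟨0, 0⟩)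
  let R ← merge P 0 L 0 (← newArray 0 ⟨0, 0⟩)
  huffman isAnd R 0 (← newArray 0 ⟨0, 0⟩) 0

/-! ## Splitting a triangular set -/

/-- Scan of the boundary sequence `B` from index `i` on, for the trees of depth `d'` and for
pairs of trees of equal depth.  `seen[k] = l + 1` if `B[l]` is the first tree of depth `k` so
far, and `seen[k] = 0` if there is none.  `best = (k + 1, j₀, j₁)` if `k` is the highest depth so
far with two trees `B[j₀]`, `B[j₁]`, `j₀ < j₁`, of depth `k`, and `best = (0, 0, 0)` if there is none.
Result: the pair `(j, j)` if there is a tree `B[j]` of depth `d'`, and otherwise the pair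
`(j₀, j₁)` of trees of equal depth with highest depth. -/
def triangularScan (B : Array Bdry) (d' i : ℕ) (seen : Array ℕ) (best : ℕ × ℕ × ℕ) :
    RAM (ℕ × ℕ) := do
  if ← lt i (← length B) then
    let k := (← read B i).depth
    if ← eq k d' then
      return (i, i)
    else
      let l ← read seen k
      let i' ← add i 1
      if ← eq l 0 then
        triangularScan B d' i' (← write seen k i') best
      else if ← le best.1 k then
        triangularScan B d' i' seen (← add k 1, ← sub l 1, i)
      else
        triangularScan B d' i' seen best
  else
    return best.2
  partial_fixpoint

/-- For the boundary sequence `B` of a set `N` with `2 ^ d' ≤ |N| < 2 ^ (d' + 1)`, determine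
indices `j₀ ≤ j₁` such that `K` is the set of inputs below `B[j₀], …, B[j₁]`. -/
def triangularSubset (B : Array Bdry) (d' : ℕ) : RAM (ℕ × ℕ) := do
  triangularScan B d' 0 (← newArray (← add d' 1) 0) (0, 0, 0)

/-- The block of the inputs below the boundary vertices in `B` other than `B[j₀], …, B[j₁]`,
where `e` is the position at which the whole block ends. -/
def remainder (B : Array Bdry) (e j₀ j₁ : ℕ) : RAM Block := do
  let j' ← add j₁ 1
  let c ← if ← lt j' (← length B) then (do return (← read B j').left) else pure e
  if ← eq j₀ 0 then
    return ⟨c, c, c, e⟩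
  else
    let a := (← read B 0).left
    let b ← add (← read B (← sub j₀ 1)).right 1
    return ⟨a, b, c, e⟩

/-! ## The recursive algorithm

For a rational number `ξ > 0` let `μ (d, n) = ξ (2 ^ d - n - 2) / d + 2`, and let `d_min (n, m)` be the
smallest `d ≥ 1` with `m ≤ μ (d, n)`. -/

/-- The data that do not change during the recursion. -/
structure Env where
  /-- numerator of `ξ` -/
  p : ℕ
  /-- denominator of `ξ` -/
  q : ℕ
  /-- number of symmetric inputs -/
  n : ℕ
  /-- table of binary logarithms -/
  lg : Array ℕ
  /-- data of the leftist And circuit on `s₀, …, s_{n-1}, t₀, t₂, …` -/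
  evenData : LeftistData
  /-- data of the leftist Or circuit on `t₁, t₃, …` -/
  oddData : LeftistData

/-- Is `m ≤ μ (d, n)`?  Here `h = 2 ^ d`, and `d ≥ 1`, `m ≥ 3`. -/
def leMu (E : Env) (m d h n : ℕ) : RAM Bool := do
  let x ← mul E.q (← mul (← sub m 2) d)
  let y ← mul E.p (← sub h (← add n 2))
  le x y

/-- Search for `d_min (n, m)` from `d` on, where `h = 2 ^ d`.  The result is `d_min (n, m)`
and its power of two. -/
def dMin (E : Env) (n m d h : ℕ) : RAM (ℕ × ℕ) := do
  if ← leMu E m d h n then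
    return (d, h)
  else
    dMin E n m (← add d 1) (← mul h 2)
  partial_fixpoint

/-- The largest odd integer `k ≤ μ (d, n)`, where `h = 2 ^ d`, `n < h` and `d ≥ 3`.  For
`n = h - 1` one has `1 ≤ μ (d, n) < 2` (for `ξ ≤ d`). -/
def oddPrefix (E : Env) (d h n : ℕ) : RAM ℕ := do
  let n' ← add n 2
  if ← le n' h then
    let z ← add (← quo (← mul E.p (← sub h n')) (← mul E.q d)) 2
    sub (← add z (← sub z (← mul 2 (← quo z 2)))) 1
  else
    return 1

/-- The number of the vertex `t_i`. -/
def tVertex (E : Env) (i : ℕ) : RAM ℕ := add E.n i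

/-- The recursive algorithm.  The alternating inputs are the `m` global inputs
`t_j, t_{j+1}, …, t_{j+m-1}`.  If `side` is `true`, then `j` is even, the symmetric inputs are the inputs
in the block `K` of the leftist And circuit, and the result is a vertex computing `f (s, t)`.
If `side` is `false`, then `j` is odd, the symmetric inputs are those in the block `K` of
the leftist Or circuit, and the result is a vertex computing `f* (s, t)`.
In both cases `K.e` is the position of `t_j` in the leftist circuit. -/
def grin (E : Env) (side : Bool) (K : Block) (j m : ℕ) : RAM ℕ := do
  let D := if side then E.evenData else E.oddData
  let e' ← add K.e 1
  -- the block of the symmetric inputs and `t_j`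
  let K' : Block := ⟨K.a, K.b, K.c, e'⟩
  let L₀ ← newArray 0 (⟨0, 0⟩ : Item)
  if ← eq m 1 then
    let B ← bdry D E.lg K'
    symTree side B 0 (← length B) L₀
  else if ← eq m 2 then
    let B ← bdry D E.lg K'
    let t₁ ← tVertex E (← add j 1)
    symTree side B 0 (← length B) (← push L₀ ⟨t₁, 0⟩)
  else
    let n ← blockSize K
    let (d, h) ← dMin E n m 1 2
    if ← le d 3 then
      -- base cases: a symmetric tree on `s`, `t_j` and one or two small circuits
      let B ← bdry D E.lg K'
      let t₁ ← tVertex E (← add j 1)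
      let t₂ ← tVertex E (← add j 2)
      if ← eq m 3 then
        let u ← newGate (!side) t₁ t₂
        symTree side B 0 (← length B) (← push L₀ ⟨u, 1⟩)
      else
        let t₃ ← tVertex E (← add j 3)
        if ← eq m 4 then
          let u ← newGate side t₂ t₃
          let w ← newGate (!side) t₁ u
          symTree side B 0 (← length B) (← push L₀ ⟨w, 2⟩)
        else
          let t₄ ← tVertex E (← add j 4)
          let u ← newGate (!side) t₁ t₂
          let w ← newGate (!side) t₃ t₄
          let z ← newGate (!side) t₁ w
          symTree side B 0 (← length B) (← push (← push L₀ ⟨u, 1⟩) ⟨z, 2⟩)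
    else
      let d' ← sub d 1
      let h' ← quo h 2
      if ← le h' n then
        -- symmetric split
        let B ← bdry D E.lg K
        let (j₀, j₁) ← triangularSubset B d'
        let u ← symTree side B j₀ (← add j₁ 1) L₀
        let R ← remainder B K.e j₀ j₁
        let v ← grin E side R j m
        newGate side u v
      else if ← leMu E m d' h' 0 then
        -- simple split
        let B ← bdry D E.lg K
        let u ← symTree side B 0 (← length B) L₀
        let v ← grin E side ⟨K.e, K.e, K.e, K.e⟩ j m
        newGate side u v
      else
        -- alternating split: `k` is odd, the second call uses `t_{j+1}, t_{j+3}, …, t_{j+k-2}` as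
        -- symmetric and `t_{j+k}, …, t_{j+m-1}` as alternating inputs
        let k ← oddPrefix E d' h' n
        let u ← grin E side K j k
        -- position of `t_{j+1}` in the other leftist circuit
        let c₀ ← quo (← add j 1) 2
        let c ← if side then pure c₀ else add E.n c₀
        let e ← add c (← quo k 2)
        let v ← grin E (!side) ⟨c, c, c, e⟩ (← add j k) (← sub m k)
        newGate side u v
  partial_fixpoint

/-! ## The whole algorithm -/

/-- Append `v, v + δ, v + 2 δ, …`, as long as they are smaller than `b`, to the array `A`. -/
def range (v δ b : ℕ) (A : Array ℕ) : RAM (Array ℕ) := do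
  if ← lt v b then
    let A' ← push A v
    range (← add v δ) δ b A'
  else
    return A
  partial_fixpoint

/-- The number of gates built so far. -/
def gateCount : RAM ℕ := fun σ => some (σ.gates.size, { σ with time := σ.time + 1 })

/-- The algorithm for `n` symmetric and `m` alternating inputs, with the parameter `ξ > 0`:
construct a leftist And circuit on `s₀, …, s_{n-1}, t₀, t₂, …` and a leftist Or circuit
on `t₁, t₃, …`, precompute their data, and start the recursion.  The result is the output vertex. -/
def andOrPath (ξ : ℚ) (n m : ℕ) : RAM ℕ := do
  let V ← add n m
  let lg ← logTable (← add V 1) 2 (← newArray 2 0)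
  let evenIns ← range n 2 V (← range 0 1 n (← newArray 0 0))
  let oddIns ← range (← add n 1) 2 V (← newArray 0 0)
  let r₀ ← length evenIns
  let r₁ ← length oddIns
  let S₀ ← leftist true lg evenIns 0 r₀ (← newArray 0 (.leaf 0 0))
  let S₁ ← leftist false lg oddIns 0 r₁ (← newArray 0 (.leaf 0 0))
  let V' ← add V (← gateCount)
  let D₀ ← precompute S₀ r₀ V'
  let D₁ ← precompute S₁ r₁ V'
  grin ⟨ξ.num.toNat, ξ.den, n, lg, D₀, D₁⟩ true ⟨0, 0, 0, n⟩ 0 m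

/-- The initial state: no gates, no steps. -/
def start (n m : ℕ) : State := ⟨n + m, #[], 0⟩

/-- The algorithm terminates on `n` symmetric and `m` alternating inputs after at most `T` steps,
without an illegal memory access. -/
def RunsWithin (ξ : ℚ) (n m : ℕ) (T : ℝ) : Prop :=
  ∃ (out : ℕ) (σ : State), andOrPath ξ n m (start n m) = some (out, σ) ∧ (σ.time : ℝ) ≤ T

end AndOr

/-! The running time is bounded by a potential. With `bound n m d` = 200n + 200(d+1)(4m − 3 +
min(n,1)) + 200md, a call of `grin` with n symmetric and m alternating inputs and m ≤ μ(d,n) costs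
at most `bound n m d` (`spec_grin`, by induction on m and then on n). Apart from its recursive
calls, a call spends O(d) steps on the search for d_min and, unless it makes an alternating split,
O(n) steps on boundary sequences and Huffman coding. These costs are paid as follows.

A symmetric split keeps d and m and leaves at most half of the symmetric inputs, so the term 200n
drops by at least 100n; as n ≥ 2^(d−1) ≥ 8, this also covers the O(d) steps. A simple split turns n
≥ 1 into 0, which frees 200n, and min(n,1) drops to 0, which frees 200(d+1). An alternating split
replaces (n, m, d) by (n, k, d−1) and (⌊k/2⌋, m−k, d). The constant −3 then occurs twice instead of
once, which pays for the O(d) steps and for min(⌊k/2⌋,1); the term 200md decreases on the first k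
inputs, which pays for the ⌊k/2⌋ new symmetric inputs. That d is still admissible in the second call
is `LeMu.right`, where ξ ≤ 2 enters.

The halving is the combinatorial core. In a leftist circuit, the subtrees are exactly the dyadic
intervals [p, p + 2^j) with 2^j ∣ p inside the range of inputs, so the depths in the boundary
sequence of an interval strictly increase and then strictly decrease (`IsBdry.unimodal`). Cutting
out one tree of depth d−1, or everything between two trees of equal depth, leaves a prefix of the
increasing part and a suffix of the decreasing part with at most half of the inputs
(`IsCut.weight_le`). Such a remainder has the same shape (`Block.IsTriangular.remove`), so the
argument repeats.

Finally d = 2⌊log₂(n+m)⌋ + 4 is admissible at the start (`leMu_of_log`, where ξ ≥ 1 enters), the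
precomputation is linear (`spec_andOrPath`), and log₂(n+m) ≤ 1 + log₂ n + log₂ m for n ≥ 1. -/

namespace AndOr

/-! ### A Hoare-style calculus for programs with a cost budget -/

/-- Started with `I` inputs and `g` gates, the program `c` terminates, the number of steps plus the
number of new gates is at most `T`, and the result together with the new number of gates
satisfies `Q`. -/
def Spec {α : Type} (I g : ℕ) (c : RAM α) (T : ℤ) (Q : α → ℕ → Prop) : Prop :=
  ∀ (G : Array Gate) (t : ℕ), G.size = g →
    ∃ (a : α) (G' : Array Gate) (t' : ℕ), c ⟨I, G, t⟩ = some (a, ⟨I, G', t'⟩) ∧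
      (t' + G'.size : ℤ) ≤ t + g + T ∧ Q a G'.size

variable {α β : Type} {I g : ℕ} {T : ℤ} {Q : α → ℕ → Prop}

/-- The budget is an integer so that T − T₁ is never truncated: an overspent budget becomes negative
and is detected by the condition 0 ≤ T of `spec_pure`. -/
theorem Spec.bind {c : RAM α} {f : α → RAM β} {T₁ : ℤ} {P : α → ℕ → Prop} {Q : β → ℕ → Prop}
    (hc : Spec I g c T₁ P) (hf : ∀ a g', P a g' → Spec I g' (f a) (T - T₁) Q) :
    Spec I g (c >>= f) T Q := by
  intro G t hG
  obtain ⟨a, G', t', h₁, h₂, h₃⟩ := hc G t hG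
  obtain ⟨b, G'', t'', h₄, h₅, h₆⟩ := hf a _ h₃ G' t' rfl
  refine ⟨b, G'', t'', ?_, by omega, h₆⟩
  change (c ⟨I, G, t⟩).bind _ = _
  rw [h₁]
  exact h₄

theorem Spec.mono {c : RAM α} {T₁ : ℤ} {P : α → ℕ → Prop} (hc : Spec I g c T₁ P) (hT : T₁ ≤ T)
    (h : ∀ a g', P a g' → Q a g') : Spec I g c T Q := by
  intro G t hG
  obtain ⟨a, G', t', h₁, h₂, h₃⟩ := hc G t hG
  exact ⟨a, G', t', h₁, by omega, h _ _ h₃⟩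

theorem spec_pure {a : α} : Spec I g (pure a) T Q ↔ 0 ≤ T ∧ Q a g := by
  constructor
  · intro h
    -- Any array of g gates serves as a test state.
    obtain ⟨a', G', t', h₁, h₂, h₃⟩ := h (Array.replicate g ⟨true, 0, 0⟩) 0 (by simp)
    have h₁ : some (a, (⟨I, Array.replicate g ⟨true, 0, 0⟩, 0⟩ : State)) = some (a', ⟨I, G', t'⟩) :=
      h₁
    simp only [Option.some.injEq, Prod.mk.injEq, State.mk.injEq, true_and] at h₁
    obtain ⟨rfl, rfl, rfl⟩ := h₁
    simp only [Array.size_replicate] at h₂ h₃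
    exact ⟨by omega, h₃⟩
  · rintro ⟨h, h'⟩ G t rfl
    exact ⟨a, G, t, rfl, by omega, h'⟩

/-- Spend `k` steps before running `c`. -/
def tick {α : Type} (k : ℕ) (c : RAM α) : RAM α := fun σ => c { σ with time := σ.time + k }

theorem Spec.tick {c : RAM α} {k : ℕ} (h : Spec I g c (T - k) Q) : Spec I g (tick k c) T Q := by
  intro G t hG
  obtain ⟨a, G', t', h₁, h₂, h₃⟩ := h G (t + k) hG
  exact ⟨a, G', t', h₁, by push_cast at h₂; omega, h₃⟩

theorem tick_bind (k : ℕ) (c : RAM α) (f : α → RAM β) : tick k c >>= f = tick k (c >>= f) := rfl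

theorem tick_tick (j k : ℕ) (c : RAM α) : tick j (tick k c) = tick (j + k) c := by
  funext σ
  simp only [tick, Nat.add_assoc]

/-- Normalization of straight-line code. -/
theorem step_rules :
    (∀ x y, add x y = tick 1 (pure (x + y))) ∧ (∀ x y, sub x y = tick 1 (pure (x - y))) ∧
    (∀ x y, mul x y = tick 1 (pure (x * y))) ∧ (∀ x y, quo x y = tick 1 (pure (x / y))) ∧
    (∀ x y, le x y = tick 1 (pure (decide (x ≤ y)))) ∧
    (∀ x y, lt x y = tick 1 (pure (decide (x < y)))) ∧
    (∀ x y, eq x y = tick 1 (pure (decide (x = y)))) ∧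
    (∀ (E : Env) x, tVertex E x = tick 1 (pure (E.n + x))) ∧
    (∀ {α : Type} (a : Array α), length a = tick 1 (pure a.size)) ∧
    (∀ {α : Type} (a : Array α) v, push a v = tick 1 (pure (a.push v))) ∧
    (∀ {α : Type} k (v : α), newArray k v = tick (k + 1) (pure (Array.replicate k v))) ∧
    (∀ {α β : Type} k (c : RAM α) (f : α → RAM β), tick k c >>= f = tick k (c >>= f)) ∧
    (∀ {α : Type} j k (c : RAM α), tick j (tick k c) = tick (j + k) c) ∧
    (∀ {α β : Type} (a : α) (f : α → RAM β), (pure a : RAM α) >>= f = f a) ∧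
    (∀ {α β γ : Type} (c : RAM α) (f : α → RAM β) (h : β → RAM γ),
      c >>= f >>= h = c >>= fun a => f a >>= h) ∧
    (∀ p : Prop, ∀ [Decidable p], (decide p = true) = p) :=
  ⟨fun _ _ => rfl, fun _ _ => rfl, fun _ _ => rfl, fun _ _ => rfl, fun _ _ => rfl, fun _ _ => rfl,
    fun _ _ => rfl, fun _ _ => rfl, fun _ => rfl, fun _ _ => rfl, fun _ _ => rfl, tick_bind,
    tick_tick, fun _ _ => rfl, fun _ _ _ => bind_assoc _ _ _, fun _ => decide_eq_true_eq⟩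

theorem read_eq {a : Array α} {i : ℕ} {v : α} (h : a[i]? = some v) :
    read a i = tick 1 (pure v) := by
  unfold read
  rw [h]
  rfl

theorem write_eq {a : Array α} {i : ℕ} (v : α) (h : i < a.size) :
    write a i v = tick 1 (pure (a.setIfInBounds i v)) := by
  unfold write
  rw [if_pos h]
  rfl

theorem spec_newGate (b : Bool) (u v : ℕ) :
    Spec I g (newGate b u v) 2 (fun a g' => a = I + g ∧ g' = g + 1) := by
  rintro G t rfl
  exact ⟨_, _, _, rfl, by simp; omega, by simp⟩

/-! ## Tables of logarithms and lists of inputs -/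

/-- `lg` contains the binary logarithms of `1, …, N`. -/
def IsLogTable (lg : Array ℕ) (N : ℕ) : Prop := ∀ j, 1 ≤ j → j ≤ N → lg[j]? = some (Nat.log 2 j)

theorem spec_logTable (N : ℕ) : ∀ (k i : ℕ) (lg : Array ℕ), N + 1 = i + k → 2 ≤ i → lg.size = i →
    IsLogTable lg (i - 1) →
    Spec I g (logTable N i lg) (6 * k + 1) (fun lg' g' => IsLogTable lg' N ∧ g' = g) := by
  intro k
  induction k with
  | zero =>
    intro i lg hN hi hs hl
    rw [logTable]
    simp only [step_rules]
    refine Spec.tick ?_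
    rw [if_neg (by omega), spec_pure]
    refine ⟨by simp, ?_, rfl⟩
    rwa [show N = i - 1 by omega]
  | succ k ih =>
    intro i lg hN hi hs hl
    rw [logTable]
    simp only [step_rules]
    refine Spec.tick ?_
    rw [if_pos (by omega)]
    have h := hl (i / 2) (by omega) (by omega)
    simp only [read_eq h, step_rules]
    refine Spec.tick ?_
    refine (ih _ _ (by omega) (by omega) (by simp [hs]) ?_).mono (by push_cast; omega)
      (fun _ _ h => h)
    -- The new entry is correct because ⌊log₂ i⌋ = ⌊log₂ ⌊i/2⌋⌋ + 1 for i ≥ 2.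
    intro j h₁ h₂
    rcases Nat.lt_or_ge j i with hj | hj
    · rw [Array.getElem?_push_lt (by omega), ← hl j h₁ (by omega), Array.getElem?_eq_getElem]
    · obtain rfl : j = i := by omega
      rw [← hs, Array.getElem?_push_size, hs, Nat.log_of_one_lt_of_le (by omega) hi]

theorem spec_range (δ b : ℕ) (hδ : 1 ≤ δ) : ∀ (k v : ℕ) (A : Array ℕ), b - v ≤ k →
    Spec I g (range v δ b A) (3 * k + 1) (fun A' g' => g' = g ∧
      A'.size = A.size + (b - v + δ - 1) / δ ∧ (∀ i, i < A.size → A'[i]? = A[i]?) ∧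
      ∀ i, v + δ * i < b → A'[A.size + i]? = some (v + δ * i)) := by
  intro k
  induction k with
  | zero =>
    intro v A hk
    rw [range]
    simp only [step_rules]
    refine Spec.tick ?_
    rw [if_neg (by omega), spec_pure]
    refine ⟨by simp, rfl, ?_, fun _ _ => rfl, fun i hi => by omega⟩
    rw [Nat.div_eq_of_lt (by omega), Nat.add_zero]
  | succ k ih =>
    intro v A hk
    rw [range]
    simp only [step_rules]
    refine Spec.tick ?_
    by_cases hv : v < b
    · rw [if_pos hv]
      refine Spec.tick ?_
      refine (ih (v + δ) (A.push v) (by omega)).mono (by push_cast; omega) ?_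
      rintro A' g' ⟨h₁, h₂, h₃, h₄⟩
      rw [Array.size_push] at h₂ h₃ h₄
      refine ⟨h₁, ?_, fun i hi => ?_, fun i hi => ?_⟩
      · rw [h₂]
        rcases Nat.lt_or_ge (v + δ) b with h | h
        · rw [show b - v + δ - 1 = (b - (v + δ) + δ - 1) + δ by omega,
            Nat.add_div_right _ (by omega)]
          omega
        · rw [Nat.div_eq_of_lt (by omega), Nat.div_eq_of_lt_le (k := 1) (by omega) (by omega)]
      · rw [h₃ i (by omega), Array.getElem?_push_lt hi, Array.getElem?_eq_getElem]
      · rcases i with _ | i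
        · rw [Nat.add_zero, h₃ _ (by omega), Array.getElem?_push_size, Nat.mul_zero, Nat.add_zero]
        · have := h₄ i (by rw [Nat.mul_succ] at hi; omega)
          rw [Nat.mul_succ, show A.size + (i + 1) = A.size + 1 + i by omega, this]
          congr 1
          omega
    · rw [if_neg hv, spec_pure]
      refine ⟨by push_cast; omega, rfl, ?_, fun _ _ => rfl, fun i hi => by omega⟩
      rw [Nat.div_eq_of_lt (by omega), Nat.add_zero]

/-! ## Construction of the leftist circuits -/

/-- `T` is an ordered full tree of depth `k` on the inputs from position `i` on, its vertices are
smaller than `N`, and `ρ` maps each of them to the position of its right-most input. -/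
def Tree.IsFull (ρ : ℕ → ℕ) (N : ℕ) : ℕ → ℕ → Tree → Prop
  | 0, i, .leaf i' v => i' = i ∧ v < N ∧ ρ v = i
  | k + 1, i, .node v T T' => IsFull ρ N k i T ∧ IsFull ρ N k (i + 2 ^ k) T' ∧ v < N ∧
      ρ v + 1 = i + 2 ^ (k + 1)
  | _, _, _ => False

theorem Tree.IsFull.mono {ρ ρ' : ℕ → ℕ} {N N' : ℕ} (hN : N ≤ N') (hρ : ∀ v, v < N → ρ' v = ρ v) :
    ∀ {k i : ℕ} {T : Tree}, T.IsFull ρ N k i → T.IsFull ρ' N' k i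
  | 0, _, .leaf _ _, ⟨h₁, h₂, h₃⟩ => ⟨h₁, by omega, by rw [hρ _ h₂, h₃]⟩
  | _ + 1, _, .node _ _ _, ⟨h₁, h₂, h₃, h₄⟩ =>
    ⟨h₁.mono hN hρ, h₂.mono hN hρ, by omega, by rw [hρ _ h₃, h₄]⟩

theorem spec_root (T : Tree) : Spec I g (root T) 1 (fun _ g' => g' = g) := by
  cases T <;>
  · rw [root]
    exact Spec.tick (c := pure _) (spec_pure.2 ⟨by simp, rfl⟩)

/-- The function ρ is a ghost variable recording the right-most position below each vertex; it is
extended whenever a gate is created and never changed on old vertices. The summand −4 makes the cost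
telescope: two halves leave 4 units for the two root lookups and the gate. -/
theorem spec_buildTree (isAnd : Bool) (ins : Array ℕ) : ∀ (k i g : ℕ) (ρ : ℕ → ℕ),
    i + 2 ^ k ≤ ins.size → (∀ j v, ins[j]? = some v → v < I ∧ ρ v = j) →
    Spec I g (buildTree isAnd ins k i) (6 * 2 ^ k - 4) (fun a g' => a.2 = i + 2 ^ k ∧ g ≤ g' ∧ g' + 1 ≤ g + 2 ^ k ∧
      ∃ ρ' : ℕ → ℕ, (∀ v, v < I + g → ρ' v = ρ v) ∧ a.1.IsFull ρ' (I + g') k i) := by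
  intro k
  induction k with
  | zero =>
    intro i g ρ hi hρ
    have h : ins[i]? = some ins[i] := Array.getElem?_eq_getElem (by simp at hi; omega)
    obtain ⟨h₁, h₂⟩ := hρ i _ h
    rw [buildTree]
    simp only [read_eq h, step_rules]
    refine Spec.tick (spec_pure.2 ⟨by simp, rfl, le_rfl, by simp, ρ, fun _ _ => rfl, rfl,
      by omega, h₂⟩)
  | succ k ih =>
    intro i g ρ hi hρ
    rw [pow_succ] at hi
    rw [buildTree]
    refine (ih i g ρ (by omega) hρ).bind ?_
    rintro ⟨T, i₁⟩ g₁ ⟨h₁, h₂, hg₁, ρ₁, h₃, h₄⟩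
    obtain rfl : i₁ = i + 2 ^ k := h₁
    refine (ih (i + 2 ^ k) g₁ ρ₁ (by omega) fun j v h =>
      ⟨(hρ j v h).1, by rw [h₃ v (by have := (hρ j v h).1; omega), (hρ j v h).2]⟩).bind ?_
    rintro ⟨T', i₂⟩ g₂ ⟨h₅, h₆, hg₂, ρ₂, h₇, h₈⟩
    obtain rfl : i₂ = i + 2 ^ k + 2 ^ k := h₅
    refine (spec_root T).bind ?_
    rintro u g₂ rfl
    refine (spec_root T').bind ?_
    rintro u' g₂ rfl
    refine (spec_newGate isAnd u u').bind ?_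
    rintro v _ ⟨rfl, rfl⟩
    rw [spec_pure]
    refine ⟨by push_cast [pow_succ]; omega, by rw [pow_succ]; omega, by omega,
      by rw [pow_succ]; omega,
      Function.update ρ₂ (I + g₂) (i + 2 ^ (k + 1) - 1), fun v hv => ?_, ?_, ?_, by omega, ?_⟩
    · rw [Function.update_of_ne (by omega), h₇ v (by omega), h₃ v hv]
    · exact h₄.mono (by omega) fun v hv => by
        rw [Function.update_of_ne (by omega), h₇ v (by omega)]
    · exact h₈.mono (by omega) fun v hv => Function.update_of_ne (by omega) _ _
    · rw [Function.update_self]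
      have := Nat.one_le_two_pow (n := k + 1)
      omega

/-- `L` is a leftist forest on the inputs at positions `i, …, r - 1`. -/
def IsForest (ρ : ℕ → ℕ) (N r : ℕ) : ℕ → List Tree → Prop
  | i, [] => i = r
  | i, T :: L => ∃ k, 2 ^ k ∣ i ∧ i + 2 ^ k ≤ r ∧ r < i + 2 ^ (k + 1) ∧ T.IsFull ρ N k i ∧
      IsForest ρ N r (i + 2 ^ k) L

theorem IsForest.mono {ρ ρ' : ℕ → ℕ} {N N' r : ℕ} (hN : N ≤ N')
    (hρ : ∀ v, v < N → ρ' v = ρ v) :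
    ∀ {i : ℕ} {L : List Tree}, IsForest ρ N r i L → IsForest ρ' N' r i L
  | _, [], h => h
  | _, _ :: _, ⟨k, h₁, h₂, h₃, h₄, h₅⟩ => ⟨k, h₁, h₂, h₃, h₄.mono hN hρ, h₅.mono hN hρ⟩

/-- This is the invariant of the leftist construction: the next free position is divisible by every
power of two that still fits. A later power is smaller than 2^k, hence divides both i and 2^k. -/
theorem two_pow_dvd_add {i r k j : ℕ} (h : ∀ j, 2 ^ j ≤ r - i → 2 ^ j ∣ i)
    (hk : i + 2 ^ k ≤ r) (hr : r < i + 2 ^ (k + 1)) (hj : 2 ^ j ≤ r - (i + 2 ^ k)) :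
    2 ^ j ∣ i + 2 ^ k := by
  rw [pow_succ] at hr
  have : j < k := by
    rw [← Nat.pow_lt_pow_iff_right (a := 2) (by norm_num)]
    omega
  exact dvd_add (h j (by omega)) (pow_dvd_pow 2 this.le)

theorem spec_leftist (isAnd : Bool) (lg ins : Array ℕ) (hlg : IsLogTable lg ins.size) :
    ∀ (r i g : ℕ) (S : Array Tree) (ρ : ℕ → ℕ),
    i + r = ins.size → (∀ j, 2 ^ j ≤ ins.size - i → 2 ^ j ∣ i) →
    (∀ j v, ins[j]? = some v → v < I ∧ ρ v = j) →
    Spec I g (leftist isAnd lg ins i r S) (7 * r + 2) (fun S' g' => g ≤ g' ∧ g' ≤ g + r ∧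
      ∃ (ρ' : ℕ → ℕ) (L : List Tree), (∀ v, v < I + g → ρ' v = ρ v) ∧ S' = S ++ L.toArray ∧
        IsForest ρ' (I + g') ins.size i L) := by
  intro r
  induction r using Nat.strong_induction_on with
  | _ r ih =>
  intro i g S ρ hr hd hρ
  rw [leftist]
  simp only [step_rules]
  refine Spec.tick ?_
  by_cases h0 : 1 ≤ r
  · rw [if_pos h0, read_eq (hlg r h0 (by omega))]
    simp only [step_rules]
    refine Spec.tick ?_
    set k := Nat.log 2 r with hk
    have h₁ : 2 ^ k ≤ r := Nat.pow_log_le_self 2 (by omega)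
    have h₂ : r < 2 ^ (k + 1) := Nat.lt_pow_succ_log_self (by norm_num) r
    have h₃ := Nat.one_le_two_pow (n := k)
    refine (spec_buildTree isAnd ins k i g ρ (by omega) hρ).bind ?_
    rintro ⟨T, i'⟩ g₁ ⟨h₄, h₅, hg₁, ρ₁, h₆, h₇⟩
    obtain rfl : i' = i + 2 ^ k := h₄
    refine Spec.tick ?_
    refine (ih _ (by omega) (i + 2 ^ k) g₁ (S.push T) ρ₁ (by omega)
      (fun j hj => two_pow_dvd_add hd (by omega) (by omega) hj) fun j v h =>
      ⟨(hρ j v h).1, by rw [h₆ v (by have := (hρ j v h).1; omega), (hρ j v h).2]⟩).mono ?_ ?_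
    · have : r - (i + 2 ^ k - i) = r - 2 ^ k := by omega
      rw [this, Nat.cast_sub h₁]
      have : (1 : ℤ) ≤ 2 ^ k := by exact_mod_cast h₃
      push_cast
      omega
    · rintro S' g' ⟨h₈, hg₂, ρ', L, h₉, h₁₀, h₁₁⟩
      refine ⟨by omega, by omega, ρ', T :: L, fun v hv => by rw [h₉ v (by omega), h₆ v hv], ?_,
        k, hd k (by omega), by omega, by omega, ?_, h₁₁⟩
      · rw [h₁₀]
        simp
      · exact h₇.mono (by omega) h₉
  · rw [if_neg h0, spec_pure]
    exact ⟨by push_cast; omega, le_rfl, by omega, ρ, [], fun _ _ => rfl, by simp, by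
      rw [IsForest]; omega⟩

/-! ## Precomputation -/

/-- The row of position `p` consists of the vertices of depth `0, …, t` with left-most input `p`,
and their right-most inputs are entered. -/
def LeftistData.HasRow (D : LeftistData) (ρ : ℕ → ℕ) (p t : ℕ) : Prop :=
  ∃ row : Array ℕ, D.desc[p]? = some row ∧ D.top[p]? = some t ∧ row.size = t + 1 ∧
    ∀ j, j ≤ t → ∃ v, row[j]? = some v ∧ D.right[v]? = some (ρ v) ∧ ρ v + 1 = p + 2 ^ j

/-- The rows of the positions `i, …, e - 1` contain precisely the vertices all of whose inputs are
smaller than `e`. -/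
def LeftistData.Filled (D : LeftistData) (ρ : ℕ → ℕ) (i e : ℕ) : Prop :=
  ∀ p, i ≤ p → p < e → ∃ t, D.HasRow ρ p t ∧ ∀ j, j ≤ t ↔ 2 ^ j ∣ p ∧ p + 2 ^ j ≤ e

/-- `D'` arises from `D` by entering vertices with left-most input in `[i, e)`. -/
structure LeftistData.Extends (D D' : LeftistData) (ρ : ℕ → ℕ) (i e : ℕ) : Prop where
  desc_size : D'.desc.size = D.desc.size
  top_size : D'.top.size = D.top.size
  right_size : D'.right.size = D.right.size
  desc_eq : ∀ p, p < i ∨ e ≤ p → D'.desc[p]? = D.desc[p]?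
  top_eq : ∀ p, p < i ∨ e ≤ p → D'.top[p]? = D.top[p]?
  right_eq : ∀ v, D.right[v]? = some (ρ v) → D'.right[v]? = some (ρ v)

theorem LeftistData.Extends.trans {D₁ D₂ D₃ : LeftistData} {ρ : ℕ → ℕ} {i e i' e' i'' e'' : ℕ}
    (h : D₁.Extends D₂ ρ i e) (h' : D₂.Extends D₃ ρ i' e') (hi : i'' ≤ i) (hi' : i'' ≤ i')
    (he : e ≤ e'') (he' : e' ≤ e'') : D₁.Extends D₃ ρ i'' e'' where
  desc_size := h'.desc_size.trans h.desc_size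
  top_size := h'.top_size.trans h.top_size
  right_size := h'.right_size.trans h.right_size
  desc_eq p hp := (h'.desc_eq p (by omega)).trans (h.desc_eq p (by omega))
  top_eq p hp := (h'.top_eq p (by omega)).trans (h.top_eq p (by omega))
  right_eq v hv := h'.right_eq v (h.right_eq v hv)

theorem LeftistData.HasRow.extends {D D' : LeftistData} {ρ : ℕ → ℕ} {i e p t : ℕ}
    (h : D.HasRow ρ p t) (h' : D.Extends D' ρ i e) (hp : p < i ∨ e ≤ p) : D'.HasRow ρ p t := by
  obtain ⟨row, h₁, h₂, h₃, h₄⟩ := h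
  refine ⟨row, (h'.desc_eq p hp).trans h₁, (h'.top_eq p hp).trans h₂, h₃, fun j hj => ?_⟩
  obtain ⟨v, h₅, h₆, h₇⟩ := h₄ j hj
  exact ⟨v, h₅, h'.right_eq v h₆, h₇⟩

/-- The vertices with left-most input a arrive in order of increasing depth, so appending puts the
vertex of depth j at index j. Overwriting an entry of `right` is harmless, because every entry for v
is `ρ v`. -/
theorem spec_enter {D : LeftistData} {ρ : ℕ → ℕ} {row : Array ℕ} {v j a b : ℕ}
    (hd : D.desc[a]? = some row) (ht : a < D.top.size) (hv : v < D.right.size) (hρ : ρ v = b)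
    (hb : b + 1 = a + 2 ^ j) (hj : row.size = j)
    (hrow : ∀ l, l < j → ∃ v, row[l]? = some v ∧ D.right[v]? = some (ρ v) ∧ ρ v + 1 = a + 2 ^ l) :
    Spec I g (enter D v j a b) 5 (fun D' g' => g' = g ∧ D.Extends D' ρ a (a + 1) ∧
      D'.HasRow ρ a j) := by
  have ha : a < D.desc.size := (Array.getElem?_eq_some_iff.1 hd).1
  have hr : ∀ w, D.right[w]? = some (ρ w) →
      (D.right.setIfInBounds v b)[w]? = some (ρ w) := fun w hw => by
    rw [Array.getElem?_setIfInBounds]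
    split_ifs with h
    · rw [← h, hρ]
    · exact hw
  rw [enter]
  simp only [read_eq hd, write_eq _ ha, write_eq _ ht, write_eq _ hv, step_rules]
  refine Spec.tick (spec_pure.2 ⟨by simp, rfl, ⟨by simp, by simp, by simp, fun p hp => ?_,
    fun p hp => ?_, hr⟩, row.push v, ?_, ?_, by simp [hj], fun l hl => ?_⟩)
  · exact Array.getElem?_setIfInBounds_ne (by omega)
  · exact Array.getElem?_setIfInBounds_ne (by omega)
  · exact Array.getElem?_setIfInBounds_self_of_lt ha
  · exact Array.getElem?_setIfInBounds_self_of_lt ht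
  · rcases Nat.lt_or_ge l j with h | h
    · obtain ⟨w, h₁, h₂, h₃⟩ := hrow l h
      refine ⟨w, ?_, hr w h₂, h₃⟩
      rw [Array.getElem?_push_lt (by omega), ← h₁, Array.getElem?_eq_getElem]
    · obtain rfl : l = j := by omega
      refine ⟨v, by rw [← hj, Array.getElem?_push_size], ?_, by rw [hρ, hb]⟩
      rw [Array.getElem?_setIfInBounds_self_of_lt hv, hρ]

/-- Both p and the end of the dyadic interval are multiples of 2^j, so their distance is at least
2^j. -/
theorem add_two_pow_le {i k p j : ℕ} (hi : 2 ^ k ∣ i) (hp : p < i + 2 ^ k) (hj : 2 ^ j ∣ p)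
    (h : j ≤ k) : p + 2 ^ j ≤ i + 2 ^ k := by
  have h₁ : 2 ^ j ∣ i + 2 ^ k - p :=
    Nat.dvd_sub (dvd_add ((pow_dvd_pow 2 h).trans hi) (pow_dvd_pow 2 h)) hj
  have := Nat.le_of_dvd (by omega) h₁
  omega

theorem spec_enterTree {ρ : ℕ → ℕ} {N : ℕ} : ∀ (k i g : ℕ) (T : Tree) (D : LeftistData),
    T.IsFull ρ N k i → 2 ^ k ∣ i → N ≤ D.right.size → i + 2 ^ k ≤ D.top.size →
    (∀ p, i ≤ p → p < i + 2 ^ k → D.desc[p]? = some #[]) →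
    Spec I g (enterTree T D) (11 * 2 ^ k - 6) (fun a g' => g' = g ∧
      D.Extends a.1 ρ i (i + 2 ^ k) ∧ a.1.Filled ρ i (i + 2 ^ k) ∧ a.2.1 = k ∧ a.2.2.1 = i ∧
      a.2.2.2 + 1 = i + 2 ^ k)
  | 0, i, g, .leaf i' v, D, ⟨h₁, h₂, h₃⟩, hi, hN, ht, hd => by
    subst h₁
    rw [enterTree.eq_def]
    refine (spec_enter (j := 0) (hd i' le_rfl (by simp)) (by simp at ht; omega) (by omega) h₃ (by simp) rfl
      (fun l hl => by omega)).bind ?_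
    rintro D' g' ⟨rfl, h₄, h₅⟩
    refine spec_pure.2 ⟨by simp, rfl, h₄, fun p hp₁ hp₂ => ?_, rfl, rfl, rfl⟩
    obtain rfl : p = i' := by simp at hp₂; omega
    refine ⟨0, h₅, fun j => ⟨fun h => ?_, fun ⟨_, h⟩ => ?_⟩⟩
    · obtain rfl : j = 0 := by omega
      simp
    · exact (Nat.pow_le_pow_iff_right (a := 2) (by norm_num)).1 (by omega)
  | k + 1, i, g, .node v U U', D, ⟨h₁, h₂, h₃, h₄⟩, hi, hN, ht, hd => by
    have hpow : 2 ^ (k + 1) = 2 ^ k + 2 ^ k := by rw [pow_succ]; omega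
    have hpos := Nat.one_le_two_pow (n := k)
    have hik : 2 ^ k ∣ i := (pow_dvd_pow 2 (by omega)).trans hi
    rw [enterTree.eq_def]
    refine (spec_enterTree k i _ U D h₁ hik hN (by omega)
      fun p hp hp' => hd p hp (by omega)).bind ?_
    rintro ⟨D₁, j, a, b₁⟩ g' ⟨rfl, e₁, f₁, hj, ha, -⟩
    obtain rfl : k = j := hj.symm
    obtain rfl : i = a := ha.symm
    dsimp only at e₁ f₁ ⊢
    refine (spec_enterTree k (i + 2 ^ k) _ U' D₁ h₂ (dvd_add hik dvd_rfl)
      (by rw [e₁.right_size]; exact hN) (by rw [e₁.top_size]; omega)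
      fun p hp hp' => by rw [e₁.desc_eq p (by omega)]; exact hd p (by omega) (by omega)).bind ?_
    rintro ⟨D₂, j₂, a₂, b⟩ g' ⟨rfl, e₂, f₂, -, -, hb⟩
    dsimp only at e₂ f₂ hb ⊢
    simp only [step_rules]
    refine Spec.tick ?_
    obtain ⟨t, ⟨row, r₁, r₂, r₃, r₄⟩, ht'⟩ := f₁ i le_rfl (by omega)
    obtain rfl : t = k := by
      have h₅ := (ht' k).2 ⟨hik, le_rfl⟩
      have h₆ := ((ht' t).1 le_rfl).2
      have := (Nat.pow_le_pow_iff_right (a := 2) (n := t) (m := k) (by norm_num)).1 (by omega)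
      omega
    refine (spec_enter (ρ := ρ) (row := row) ((e₂.desc_eq i (by omega)).trans r₁)
      (by rw [e₂.top_size, e₁.top_size]; omega)
      (by rw [e₂.right_size, e₁.right_size]; omega) (by omega) (by omega) r₃
      (fun l hl => ?_)).bind ?_
    · obtain ⟨w, h₅, h₆, h₇⟩ := r₄ l (by omega)
      exact ⟨w, h₅, e₂.right_eq w h₆, h₇⟩
    rintro D₃ g' ⟨rfl, e₃, f₃⟩
    refine spec_pure.2 ⟨?_, rfl, ?_, fun p hp₁ hp₂ => ?_, rfl, rfl, by dsimp only; omega⟩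
    · push_cast [pow_succ]
      omega
    · exact (e₁.trans e₂ (i'' := i) (e'' := i + 2 ^ (t + 1)) le_rfl (by omega) (by omega)
        (by omega)).trans e₃ le_rfl le_rfl le_rfl (by omega)
    · rcases Nat.lt_or_ge i p with hp | hp
      · rcases Nat.lt_or_ge p (i + 2 ^ t) with hp' | hp'
        · obtain ⟨s, h₅, h₆⟩ := f₁ p hp₁ hp'
          refine ⟨s, (h₅.extends e₂ (by omega)).extends e₃ (by omega), fun j => ?_⟩
          rw [h₆]
          refine and_congr_right fun hj => ⟨fun h => by omega, fun h => ?_⟩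
          -- An aligned interval starting strictly inside the left half cannot reach into the right
          -- half: for j > t, both i and p would be multiples of 2^(t+1), so p would lie beyond the
          -- left half.
          refine add_two_pow_le hik hp' hj (Nat.le_of_lt_succ (Nat.lt_of_not_le fun hlt => ?_))
          have := Nat.le_of_dvd (by omega)
            (Nat.dvd_sub ((pow_dvd_pow 2 hlt).trans hj) hi)
          omega
        · obtain ⟨s, h₅, h₆⟩ := f₂ p hp' (by omega)
          refine ⟨s, h₅.extends e₃ (by omega), fun j => ?_⟩
          rw [h₆, hpow, Nat.add_assoc]
      · obtain rfl : p = i := by omega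
        refine ⟨t + 1, f₃, fun j => ⟨fun h => ⟨(pow_dvd_pow 2 h).trans hi, ?_⟩, fun h => ?_⟩⟩
        · have := Nat.pow_le_pow_right (n := 2) (by norm_num) h
          omega
        · exact (Nat.pow_le_pow_iff_right (a := 2) (by norm_num)).1 (by omega)

theorem spec_enterForest {ρ : ℕ → ℕ} {N r : ℕ} (S : Array Tree) : ∀ (L : List Tree) (l i : ℕ)
    (D : LeftistData), S.toList.drop l = L → l ≤ S.size → i ≤ r → IsForest ρ N r i L →
    N ≤ D.right.size → r = D.top.size → (∀ p, i ≤ p → p < r → D.desc[p]? = some #[]) →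
    Spec I g (enterForest S l D) (11 * (r - i) + 2) (fun D' g' => g' = g ∧
      D.Extends D' ρ i r ∧ D'.Filled ρ i r) := by
  intro L
  induction L with
  | nil =>
    intro l i D hL hl hir hF hN hr hd
    have hl' : S.size ≤ l := by simpa using List.drop_eq_nil_iff.1 hL
    rw [enterForest]
    simp only [step_rules]
    refine Spec.tick ?_
    rw [if_neg (by omega), spec_pure]
    refine ⟨by push_cast; omega, rfl, ⟨rfl, rfl, rfl, fun _ _ => rfl, fun _ _ => rfl,
      fun _ h => h⟩, fun p h₁ h₂ => ?_⟩
    have : i = r := hF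
    omega
  | cons T L ih =>
    rintro l i D hL hl hir ⟨k, h₁, h₂, h₃, h₄, h₅⟩ hN hr hd
    have hl' : l < S.size := by
      by_contra h
      rw [List.drop_eq_nil_of_le (by simp; omega)] at hL
      exact List.cons_ne_nil _ _ hL.symm
    have hpos := Nat.one_le_two_pow (n := k)
    have hS : S[l]? = some T := by
      rw [← Array.getElem?_toList, ← Nat.add_zero l, ← List.getElem?_drop, hL]
      rfl
    rw [enterForest]
    simp only [step_rules]
    refine Spec.tick ?_
    rw [if_pos hl', read_eq hS]
    simp only [step_rules]
    refine Spec.tick ?_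
    refine (spec_enterTree k i _ T D h₄ h₁ hN (by omega)
      (fun p hp hp' => hd p hp (by omega))).bind ?_
    rintro ⟨D₁, a⟩ g' ⟨rfl, e₁, f₁, -⟩
    dsimp only at e₁ f₁ ⊢
    refine Spec.tick ?_
    refine (ih (l + 1) (i + 2 ^ k) D₁ ?_ (by omega) h₂ h₅ (by rw [e₁.right_size]; exact hN)
      (by rw [e₁.top_size]; exact hr) fun p hp hp' => by
        rw [e₁.desc_eq p (by omega)]; exact hd p (by omega) hp').mono ?_ ?_
    · rw [← List.drop_drop, hL]
      rfl
    · push_cast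
      omega
    · rintro D₂ g' ⟨rfl, e₂, f₂⟩
      refine ⟨rfl, e₁.trans e₂ le_rfl (by omega) (by omega) le_rfl, fun p hp hp' => ?_⟩
      rcases Nat.lt_or_ge p (i + 2 ^ k) with h | h
      · obtain ⟨s, h₆, h₇⟩ := f₁ p hp h
        refine ⟨s, h₆.extends e₂ (by omega), fun j => ?_⟩
        rw [h₇]
        refine and_congr_right fun hj => ⟨fun h => by omega, fun h' => ?_⟩
        -- An interval longer than the current tree would end beyond r, since the tree is the
        -- largest that fits.
        refine add_two_pow_le h₁ h hj (Nat.le_of_lt_succ (Nat.lt_of_not_le fun hlt => ?_))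
        have := Nat.pow_le_pow_right (n := 2) (by norm_num) hlt
        rw [Nat.succ_eq_add_one] at this
        omega
      · exact f₂ p h hp'

/-- The data of a leftist circuit on `r` inputs are correct. -/
def LeftistData.IsCorrect (D : LeftistData) (r : ℕ) : Prop := ∃ ρ, D.Filled ρ 0 r

theorem spec_precompute {ρ : ℕ → ℕ} {r V : ℕ} {L : List Tree} (h : IsForest ρ V r 0 L) :
    Spec I g (precompute L.toArray r V) (13 * r + V + 5) (fun D g' => g' = g ∧ D.IsCorrect r) := by
  rw [precompute]
  simp only [step_rules]
  refine Spec.tick ?_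
  refine (spec_enterForest (L.toArray) L 0 0 _ (by simp) (by simp) (by omega) h (by simp)
    (by simp) fun p _ hp => ?_).mono ?_ ?_
  · simp only [Array.getElem?_replicate, if_pos hp]
  · push_cast
    omega
  · rintro D g' ⟨h₁, -, h₂⟩
    exact ⟨h₁, ρ, h₂⟩

/-! ## Symmetric trees -/

theorem spec_sortBdry (B : Array Bdry) : ∀ (k g i j : ℕ) (P : Array Item), i + k = j →
    j ≤ B.size → Spec I g (sortBdry B i j P) (7 * k + 1) (fun P' _ => P'.size = P.size + k) := by
  intro k
  induction k with
  | zero =>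
    intro g i j P hk hj
    rw [sortBdry]
    simp only [step_rules]
    refine Spec.tick ?_
    rw [if_neg (by omega), spec_pure]
    exact ⟨by simp, rfl⟩
  | succ k ih =>
    intro g i j P hk hj
    rw [sortBdry]
    simp only [step_rules]
    refine Spec.tick ?_
    have h₁ : B[i]? = some B[i] := Array.getElem?_eq_getElem (by omega)
    have h₂ : B[j - 1]? = some B[j - 1] := Array.getElem?_eq_getElem (by omega)
    rw [if_pos (by omega), read_eq h₁, read_eq h₂]
    simp only [step_rules]
    refine Spec.tick ?_
    split_ifs
    · refine Spec.tick ((ih _ _ _ _ (by omega) hj).mono (by push_cast; omega) fun P' _ h => ?_)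
      rw [h, Array.size_push]
      omega
    · refine Spec.tick ((ih _ _ _ _ (by omega) (by omega)).mono (by push_cast; omega)
        fun P' _ h => ?_)
      rw [h, Array.size_push]
      omega

theorem spec_popMin {P Q : Array Item} {i j : ℕ} (h : i < P.size ∨ j < Q.size) :
    Spec I g (popMin P i Q j) 8 (fun a _ => a.2.1 = i + 1 ∧ a.2.2 = j ∧ i < P.size ∨
      a.2.1 = i ∧ a.2.2 = j + 1 ∧ j < Q.size) := by
  rw [popMin]
  simp only [step_rules]
  refine Spec.tick ?_
  by_cases hi : i < P.size
  · have h₁ : P[i]? = some P[i] := Array.getElem?_eq_getElem hi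
    rw [if_pos hi, read_eq h₁]
    simp only [step_rules]
    refine Spec.tick ?_
    by_cases hj : j < Q.size
    · have h₂ : Q[j]? = some Q[j] := Array.getElem?_eq_getElem hj
      rw [if_pos hj, read_eq h₂]
      simp only [step_rules]
      refine Spec.tick ?_
      split_ifs <;> refine Spec.tick (spec_pure.2 ⟨by simp, ?_⟩)
      · exact .inl ⟨rfl, rfl, hi⟩
      · exact .inr ⟨rfl, rfl, hj⟩
    · rw [if_neg hj]
      exact Spec.tick (spec_pure.2 ⟨by simp, .inl ⟨rfl, rfl, hi⟩⟩)
  · have hj : j < Q.size := by omega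
    have h₂ : Q[j]? = some Q[j] := Array.getElem?_eq_getElem hj
    rw [if_neg hi, read_eq h₂]
    simp only [step_rules]
    exact Spec.tick (spec_pure.2 ⟨by simp, .inr ⟨rfl, rfl, hj⟩⟩)

theorem spec_merge (P Q : Array Item) : ∀ (k g i j : ℕ) (R : Array Item),
    i + j + k = P.size + Q.size → i ≤ P.size → j ≤ Q.size →
    Spec I g (merge P i Q j R) (13 * k + 4) (fun R' _ => R'.size = R.size + k) := by
  intro k
  induction k with
  | zero =>
    intro g i j R hk hi hj
    rw [merge]
    simp only [step_rules, Bool.or_eq_true]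
    refine Spec.tick ?_
    rw [if_neg (by omega), spec_pure]
    exact ⟨by simp, rfl⟩
  | succ k ih =>
    intro g i j R hk hi hj
    rw [merge]
    simp only [step_rules, Bool.or_eq_true]
    refine Spec.tick ?_
    rw [if_pos (by omega)]
    refine (spec_popMin (by omega)).bind ?_
    rintro ⟨u, i', j'⟩ g' h
    dsimp only at h ⊢
    refine Spec.tick ((ih _ _ _ _ ?_ ?_ ?_).mono (by push_cast; omega) fun R' _ h => ?_)
    iterate 3 omega
    rw [h, Array.size_push]
    omega

/-- Each round removes two items and appends one, so k + 1 remaining items need k rounds.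
Termination and cost depend only on the queue sizes, not on the order of the arrival times. -/
theorem spec_huffman (isAnd : Bool) (P : Array Item) : ∀ (k g i j : ℕ) (Q : Array Item),
    i + j + (k + 1) = P.size + Q.size → i ≤ P.size → j ≤ Q.size →
    Spec I g (huffman isAnd P i Q j) (25 * k + 12) (fun _ _ => True) := by
  intro k
  induction k with
  | zero =>
    intro g i j Q hk hi hj
    rw [huffman]
    refine (spec_popMin (by omega)).bind ?_
    rintro ⟨u, i', j'⟩ g' h
    dsimp only at h ⊢
    simp only [step_rules, Bool.or_eq_true]
    refine Spec.tick ?_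
    rw [if_neg (by omega), spec_pure]
    exact ⟨by simp, trivial⟩
  | succ k ih =>
    intro g i j Q hk hi hj
    rw [huffman]
    refine (spec_popMin (by omega)).bind ?_
    rintro ⟨u, i₁, j₁⟩ g' h
    dsimp only at h ⊢
    simp only [step_rules, Bool.or_eq_true]
    refine Spec.tick ?_
    rw [if_pos (by omega)]
    refine (spec_popMin (by omega)).bind ?_
    rintro ⟨v, i₂, j₂⟩ g' h'
    dsimp only at h' ⊢
    refine (spec_newGate _ _ _).bind ?_
    rintro w g' -
    refine Spec.tick ?_
    split_ifs <;>
    · refine Spec.tick ((ih _ _ _ _ ?_ ?_ ?_).mono (by push_cast; omega) fun _ _ h => h)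
      all_goals (try rw [Array.size_push]); omega

theorem spec_symTree (isAnd : Bool) (B : Array Bdry) (i j : ℕ) (L : Array Item) (hi : i ≤ j)
    (hj : j ≤ B.size) (h : 1 ≤ j - i + L.size) :
    Spec I g (symTree isAnd B i j L) (45 * (j - i) + 38 * L.size) (fun _ _ => True) := by
  rw [symTree]
  simp only [step_rules]
  refine Spec.tick ?_
  refine (spec_sortBdry B (j - i) _ _ _ _ (by omega) hj).bind ?_
  intro P g' hP
  refine Spec.tick ?_
  refine (spec_merge P L (P.size + L.size) _ 0 0 _ (by omega) (by omega) (by omega)).bind ?_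
  intro R g' hR
  refine Spec.tick ?_
  simp only [Array.size_replicate, Nat.zero_add] at hP hR
  refine (spec_huffman isAnd R (R.size - 1) _ 0 0 _ (by simp; omega) (by omega) (by simp)).mono
    ?_ fun _ _ h => h
  push_cast
  omega

/-! ## Boundary sequences -/

/-- `L` is the boundary sequence of the set `[i, b)` of positions. -/
def IsBdry (b : ℕ) : ℕ → List Bdry → Prop
  | i, [] => i = b
  | i, x :: L => x.left = i ∧ x.right + 1 = i + 2 ^ x.depth ∧ 2 ^ x.depth ∣ i ∧
      i + 2 ^ x.depth ≤ b ∧ ¬ (2 ^ (x.depth + 1) ∣ i ∧ i + 2 ^ (x.depth + 1) ≤ b) ∧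
      IsBdry b (i + 2 ^ x.depth) L

/-- The number of inputs below a list of boundary vertices. -/
def bdrySize (L : List Bdry) : ℕ := (L.map fun x => 2 ^ x.depth).sum

theorem bdrySize_append (L L' : List Bdry) : bdrySize (L ++ L') = bdrySize L + bdrySize L' := by
  simp [bdrySize]

theorem length_le_bdrySize (L : List Bdry) : L.length ≤ bdrySize L := by
  induction L with
  | nil => simp
  | cons x L ih =>
    have := Nat.one_le_two_pow (n := x.depth)
    simp only [bdrySize, List.map_cons, List.sum_cons, List.length_cons] at ih ⊢
    omega

theorem IsBdry.add_size {b : ℕ} : ∀ {i : ℕ} {L : List Bdry}, IsBdry b i L → i + bdrySize L = b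
  | _, [], h => h
  | i, x :: L, ⟨_, _, _, _, _, h⟩ => by
    have := h.add_size
    simp only [bdrySize, List.map_cons, List.sum_cons] at this ⊢
    omega

/-- Shrinking the interval to the end of an initial segment preserves maximality, since fewer dyadic
intervals fit. Hence a recursive call that recomputes the boundary of a remaining part finds the
same trees again. -/
theorem IsBdry.prefix {b : ℕ} : ∀ {i : ℕ} {L L' : List Bdry}, IsBdry b i (L ++ L') →
    IsBdry (i + bdrySize L) i L ∧ IsBdry b (i + bdrySize L) L'
  | _, [], _, h => ⟨rfl, h⟩
  | i, x :: L, L', ⟨h₁, h₂, h₃, h₄, h₅, h₆⟩ => by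
    obtain ⟨h₇, h₈⟩ := h₆.prefix
    have h₉ : i + bdrySize (x :: L) = i + 2 ^ x.depth + bdrySize L := by
      simp only [bdrySize, List.map_cons, List.sum_cons]
      omega
    rw [h₉]
    exact ⟨⟨h₁, h₂, h₃, by omega, fun h => h₅ ⟨h.1, by have := h₈.add_size; omega⟩, h₇⟩, h₈⟩

theorem spec_intervalBdry {D : LeftistData} {r N b : ℕ} {lg : Array ℕ} (hD : D.IsCorrect r)
    (hlg : IsLogTable lg N) (hN : r ≤ N) (hb : b ≤ r) : ∀ (k g i : ℕ) (B : Array Bdry),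
    b - i = k → i ≤ b → Spec I g (intervalBdry D lg b i B) (10 * k + 1) (fun B' _ =>
      ∃ L : List Bdry, B' = B ++ L.toArray ∧ IsBdry b i L) := by
  obtain ⟨ρ, hD⟩ := hD
  intro k
  induction k using Nat.strong_induction_on with
  | _ k ih =>
  intro g i B hk hi
  rw [intervalBdry]
  simp only [step_rules]
  refine Spec.tick ?_
  by_cases h : i < b
  · obtain ⟨t, ⟨row, h₁, h₂, h₃, h₄⟩, h₅⟩ := hD i (by omega) (by omega)
    rw [if_pos h, read_eq (hlg (b - i) (by omega) (by omega)), read_eq h₂]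
    simp only [step_rules]
    refine Spec.tick ?_
    -- The depth j is the smaller of ⌊log₂(b − i)⌋ and t; the argument is the same whichever of the
    -- two it is.
    have key : ∀ j, j ≤ t → 2 ^ j ≤ b - i → ¬ (j + 1 ≤ t ∧ 2 ^ (j + 1) ≤ b - i) →
        Spec I g (read D.desc i >>= fun c => read c j >>= fun v => read D.right v >>= fun r' =>
          tick 2 (intervalBdry D lg b (r' + 1) (B.push ⟨v, j, i, r'⟩)))
          (10 * k + 1 - 1 - 4) (fun B' _ =>
            ∃ L : List Bdry, B' = B ++ L.toArray ∧ IsBdry b i L) := by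
      intro j h₆ h₇ h₈
      obtain ⟨v, h₉, h₁₀, h₁₁⟩ := h₄ j h₆
      have hpos := Nat.one_le_two_pow (n := j)
      rw [read_eq h₁]
      simp only [step_rules]
      refine Spec.tick ?_
      rw [read_eq h₉]
      simp only [step_rules]
      refine Spec.tick ?_
      rw [read_eq h₁₀]
      simp only [step_rules]
      refine Spec.tick ?_
      rw [h₁₁]
      refine (ih _ (by omega) g (i + 2 ^ j) _ rfl (by omega)).mono ?_ ?_
      · push_cast
        omega
      · rintro B' _ ⟨L, rfl, hL⟩
        refine ⟨⟨v, j, i, ρ v⟩ :: L, by simp, rfl, h₁₁, ((h₅ j).1 h₆).1, by dsimp only; omega,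
          fun h => h₈ ⟨(h₅ _).2 ⟨h.1, ?_⟩, ?_⟩, hL⟩
        · have := h.2
          dsimp only at this
          omega
        · have := h.2
          dsimp only at this
          omega
    split_ifs with hle
    · refine key _ hle (Nat.pow_log_le_self 2 (by omega)) fun h => ?_
      have := Nat.lt_pow_succ_log_self (b := 2) (by norm_num) (b - i)
      omega
    · exact key _ le_rfl (Nat.pow_le_of_le_log (by omega) (by omega)) fun h => by omega
  · rw [if_neg h, spec_pure]
    exact ⟨by push_cast; omega, [], by simp, by rw [IsBdry]; omega⟩

/-- The number of positions in a block. -/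
def Block.size (K : Block) : ℕ := K.b - K.a + (K.e - K.c)

theorem spec_bdry {D : LeftistData} {r N : ℕ} {lg : Array ℕ} {K : Block} (hD : D.IsCorrect r)
    (hlg : IsLogTable lg N) (hN : r ≤ N) (hab : K.a ≤ K.b) (hbr : K.b ≤ r) (hce : K.c ≤ K.e)
    (her : K.e ≤ r) : Spec I g (bdry D lg K) (10 * K.size + 3) (fun B _ =>
      ∃ L₁ L₂ : List Bdry, B = (L₁ ++ L₂).toArray ∧ IsBdry K.b K.a L₁ ∧ IsBdry K.e K.c L₂) := by
  rw [bdry]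
  simp only [step_rules]
  refine Spec.tick ?_
  refine (spec_intervalBdry hD hlg hN hbr _ _ _ _ rfl hab).bind ?_
  rintro B g' ⟨L₁, rfl, h₁⟩
  refine (spec_intervalBdry hD hlg hN her _ _ _ _ rfl hce).mono ?_ ?_
  · rw [Block.size]
    push_cast
    omega
  · rintro B g' ⟨L₂, rfl, h₂⟩
    exact ⟨L₁, L₂, by simp, h₁, h₂⟩

/-! ## Triangular sets -/

/-- The depths of a list of boundary vertices. -/
def depths (L : List Bdry) : List ℕ := L.map Bdry.depth

/-- The number of inputs of trees with the given depths. -/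
def weight (l : List ℕ) : ℕ := (l.map (2 ^ ·)).sum

theorem weight_depths (L : List Bdry) : weight (depths L) = bdrySize L := by
  simp [weight, depths, bdrySize, Function.comp_def]

theorem weight_append (l l' : List ℕ) : weight (l ++ l') = weight l + weight l' := by
  simp [weight]

theorem weight_cons (a : ℕ) (l : List ℕ) : weight (a :: l) = 2 ^ a + weight l := by
  simp [weight]

theorem two_pow_le_weight {l : List ℕ} {a : ℕ} (ha : a ∈ l) : 2 ^ a ≤ weight l :=
  List.single_le_sum (by simp) _ (List.mem_map_of_mem ha)

theorem weight_lt {l : List ℕ} {k : ℕ} (h : l.Nodup) (hk : ∀ a ∈ l, a < k) : weight l < 2 ^ k := by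
  rw [weight, ← List.sum_toFinset _ h]
  exact Nat.geomSum_lt le_rfl fun a ha => hk a (List.mem_toFinset.1 ha)

theorem eq_take_append_cons_drop {γ : Type} {l : List γ} {j : ℕ} {k : γ}
    (h : l[j]? = some k) : l = l.take j ++ k :: l.drop (j + 1) := by
  obtain ⟨h₁, rfl⟩ := List.getElem?_eq_some_iff.1 h
  rw [List.getElem_cons_drop, List.take_append_drop]

/-- The pair `(j₀, j₁)` consists of the index of one tree of depth `d'`, or of the indices of two trees
of equal depth. -/
def IsCut (l : List ℕ) (d' j₀ j₁ : ℕ) : Prop :=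
  j₀ = j₁ ∧ l[j₀]? = some d' ∨ ∃ k, j₀ < j₁ ∧ l[j₀]? = some k ∧ l[j₁]? = some k

/-- The lists x and y are the increasing and the decreasing part. The cut meets the peak between
them, so what remains is a prefix of x and a suffix of y. -/
theorem IsCut.weight_le {x y : List ℕ} (hx : x.Pairwise (· < ·)) (hy : y.Pairwise (· > ·))
    {d' j₀ j₁ : ℕ} (hw : weight (x ++ y) < 2 ^ (d' + 1)) (h : IsCut (x ++ y) d' j₀ j₁) :
    j₀ ≤ j₁ ∧ j₁ < (x ++ y).length ∧ j₀ ≤ x.length ∧ x.length ≤ j₁ + 1 ∧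
      2 * (weight ((x ++ y).take j₀) + weight ((x ++ y).drop (j₁ + 1))) ≤ weight (x ++ y) := by
  have hmem : ∀ a ∈ x ++ y, a ≤ d' := fun a ha => by
    have := (two_pow_le_weight ha).trans_lt hw
    have := (Nat.pow_lt_pow_iff_right (by norm_num)).1 this
    omega
  have hx' : ∀ i j a b, i < j → x[i]? = some a → x[j]? = some b → a < b := fun i j a b hij ha hb => by
    obtain ⟨h₁, rfl⟩ := List.getElem?_eq_some_iff.1 ha
    obtain ⟨h₂, rfl⟩ := List.getElem?_eq_some_iff.1 hb
    exact List.pairwise_iff_getElem.1 hx _ _ _ _ hij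
  have hy' : ∀ i j a b, i < j → y[i]? = some a → y[j]? = some b → b < a := fun i j a b hij ha hb => by
    obtain ⟨h₁, rfl⟩ := List.getElem?_eq_some_iff.1 ha
    obtain ⟨h₂, rfl⟩ := List.getElem?_eq_some_iff.1 hb
    exact List.pairwise_iff_getElem.1 hy _ _ _ _ hij
  rcases h with ⟨rfl, h⟩ | ⟨k, hj, h₀, h₁⟩
  · have hlen := (List.getElem?_eq_some_iff.1 h).1
    -- By `hmem`, d' is the largest possible depth, so the tree is the last one of x or the first
    -- one of y. It contains 2^d' inputs, more than half of the total.
    refine ⟨le_rfl, hlen, ?_, ?_, ?_⟩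
    · by_contra! hlt
      rw [List.getElem?_append_right hlt.le] at h
      have hlen' := (List.getElem?_eq_some_iff.1 h).1
      have h0 : y[0]? = some y[0] := List.getElem?_eq_getElem (by omega)
      have := hy' 0 _ _ _ (by omega) h0 h
      have := hmem y[0] (by simp)
      omega
    · by_contra! hlt
      rw [List.getElem?_append_left (by omega)] at h
      have h0 : x[j₀ + 1]? = some x[j₀ + 1] := List.getElem?_eq_getElem hlt
      have := hx' _ _ _ _ (by omega) h h0
      have := hmem x[j₀ + 1] (by simp)
      omega
    · have := congrArg weight (eq_take_append_cons_drop h)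
      rw [weight_append (_ : List ℕ) (d' :: _), weight_cons] at this
      rw [pow_succ] at hw
      omega
  · have hlen := (List.getElem?_eq_some_iff.1 h₁).1
    have hj₀ : j₀ < x.length := by
      by_contra! hle
      rw [List.getElem?_append_right hle] at h₀
      rw [List.getElem?_append_right (by omega)] at h₁
      exact lt_irrefl _ (hy' _ _ _ _ (by omega) h₀ h₁)
    have hj₁ : x.length ≤ j₁ := by
      by_contra! hlt
      rw [List.getElem?_append_left hj₀] at h₀
      rw [List.getElem?_append_left hlt] at h₁
      exact lt_irrefl _ (hx' _ _ _ _ hj h₀ h₁)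
    refine ⟨hj.le, hlen, hj₀.le, by omega, ?_⟩
    have h₂ := eq_take_append_cons_drop h₀
    have h₃ : ((x ++ y).drop (j₀ + 1))[j₁ - (j₀ + 1)]? = some k := by
      rw [List.getElem?_drop, ← h₁]
      congr 1
      omega
    have h₄ := congrArg weight (eq_take_append_cons_drop h₃)
    have h₅ := congrArg weight h₂
    rw [weight_append, weight_cons, List.drop_drop,
      show j₀ + 1 + (j₁ - (j₀ + 1) + 1) = j₁ + 1 by omega] at h₄
    rw [weight_append (_ : List ℕ) (k :: _), weight_cons] at h₅
    rw [List.getElem?_append_left hj₀] at h₀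
    rw [List.getElem?_append_right hj₁] at h₁
    -- The trees outside the cut on either side have distinct depths below k and hence fewer than
    -- 2^k inputs per side, while the cut contains at least 2 · 2^k.
    have h₆ : weight ((x ++ y).take j₀) < 2 ^ k := by
      rw [List.take_append_of_le_length hj₀.le]
      refine weight_lt ((hx.imp fun h => h.ne).sublist (List.take_sublist _ _)) fun a ha => ?_
      obtain ⟨i, hi, rfl⟩ := List.mem_iff_getElem.1 ha
      rw [List.length_take] at hi
      rw [List.getElem_take]
      exact hx' i j₀ _ _ (by omega) (List.getElem?_eq_getElem _) h₀
    have h₇ : weight ((x ++ y).drop (j₁ + 1)) < 2 ^ k := by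
      rw [List.drop_append, List.drop_eq_nil_of_le (by omega), List.nil_append]
      refine weight_lt ((hy.imp fun h => h.ne').sublist (List.drop_sublist _ _)) fun a ha => ?_
      obtain ⟨i, hi, rfl⟩ := List.mem_iff_getElem.1 ha
      rw [List.length_drop] at hi
      rw [List.getElem_drop]
      exact hy' (j₁ - x.length) _ _ _ (by omega) h₁ (List.getElem?_eq_getElem _)
    omega

theorem spec_triangularScan {B : Array Bdry} {l : List ℕ} (hl : depths B.toList = l) {d' : ℕ}
    (hw : weight l < 2 ^ (d' + 1)) (hw' : 2 ^ d' ≤ weight l) :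
    ∀ (k i g : ℕ) (seen : Array ℕ) (best : ℕ × ℕ × ℕ), i + k = l.length → seen.size = d' + 1 →
    (∀ j, j < i → l[j]? ≠ some d') →
    (∀ k s, seen[k]? = some s → if s = 0 then ∀ j, j < i → l[j]? ≠ some k else
      s - 1 < i ∧ l[s - 1]? = some k) →
    (best.1 = 0 ∨ best.2.1 < best.2.2 ∧ l[best.2.1]? = some (best.1 - 1) ∧
      l[best.2.2]? = some (best.1 - 1)) →
    (∀ j j' k, j < j' → j' < i → l[j]? = some k → l[j']? = some k → k < best.1) →
    Spec I g (triangularScan B d' i seen best) (10 * k + 2)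
      (fun a _ => IsCut l d' a.1 a.2) := by
  have hsize : B.size = l.length := by simp [← hl, depths]
  have hmem : ∀ a ∈ l, a ≤ d' := fun a ha => by
    have := (two_pow_le_weight ha).trans_lt hw
    have := (Nat.pow_lt_pow_iff_right (by norm_num)).1 this
    omega
  intro k
  induction k with
  | zero =>
    intro i g seen best hi hs h₁ h₂ h₃ h₄
    rw [triangularScan]
    simp only [step_rules]
    refine Spec.tick ?_
    rw [if_neg (by omega), spec_pure]
    refine ⟨by simp, ?_⟩
    rcases h₃ with h₃ | ⟨h₃, h₅, h₆⟩
    -- Without a tree of depth d' and without a repeated depth, the depths would be distinct and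
    -- below d', giving total weight less than 2^d'.
    · exfalso
      refine (weight_lt (l := l) (k := d') ?_ fun a ha => ?_).not_ge hw'
      · refine List.pairwise_iff_getElem.2 fun j j' hj hj' hlt heq => ?_
        have := h₄ j j' l[j] hlt (by omega) (List.getElem?_eq_getElem _)
          (by rw [heq]; exact List.getElem?_eq_getElem _)
        omega
      · obtain ⟨j, hj, rfl⟩ := List.mem_iff_getElem.1 ha
        refine lt_of_le_of_ne (hmem _ ha) fun h => ?_
        exact h₁ j (by omega) (by rw [← h]; exact List.getElem?_eq_getElem _)
    · exact .inr ⟨_, h₃, h₅, h₆⟩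
  | succ k ih =>
    intro i g seen best hi hs h₁ h₂ h₃ h₄
    rw [triangularScan]
    simp only [step_rules]
    refine Spec.tick ?_
    have hB : B[i]? = some B[i] := Array.getElem?_eq_getElem (by omega)
    have hli : l[i]? = some B[i].depth := by
      simp [← hl, depths, hB]
    rw [if_pos (by omega), read_eq hB]
    simp only [step_rules]
    refine Spec.tick ?_
    by_cases hd : B[i].depth = d'
    · rw [if_pos hd, spec_pure]
      exact ⟨by push_cast; omega, .inl ⟨rfl, by rw [hli, hd]⟩⟩
    have hdlt : B[i].depth < seen.size := by
      have := hmem _ (List.mem_of_getElem? hli)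
      omega
    have hseen : seen[B[i].depth]? = some seen[B[i].depth] := Array.getElem?_eq_getElem hdlt
    have h₁' : ∀ j, j < i + 1 → l[j]? ≠ some d' := fun j hj => by
      rcases Nat.lt_succ_iff_lt_or_eq.1 hj with h | rfl
      · exact h₁ j h
      · rw [hli]
        simpa using hd
    rw [if_neg hd, read_eq hseen]
    simp only [step_rules]
    refine Spec.tick ?_
    have h₅ := h₂ _ _ hseen
    by_cases h0 : seen[B[i].depth] = 0
    · rw [if_pos h0, write_eq _ hdlt]
      rw [if_pos h0] at h₅
      simp only [step_rules]
      refine Spec.tick ((ih (i + 1) _ _ _ (by omega) (by simpa using hs) h₁' ?_ h₃ ?_).mono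
        (by push_cast; omega) fun _ _ h => h)
      · intro c s hc
        rw [Array.getElem?_setIfInBounds] at hc
        split_ifs at hc with h₆
        · obtain rfl : i + 1 = s := by simpa using hc
          rw [if_neg (by omega), Nat.add_sub_cancel, ← h₆]
          exact ⟨by omega, hli⟩
        · have := h₂ c s hc
          split_ifs at this ⊢
          · intro j hj
            rcases Nat.lt_succ_iff_lt_or_eq.1 hj with h | rfl
            · exact this j h
            · rw [hli]
              simpa using h₆
          · exact ⟨by omega, this.2⟩
      · intro j j' c hlt hlt' hc hc'
        rcases Nat.lt_succ_iff_lt_or_eq.1 hlt' with h | rfl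
        · exact h₄ j j' c hlt h hc hc'
        · rw [hli] at hc'
          rw [← hc'] at hc
          exact absurd hc (h₅ j hlt)
    rw [if_neg h0]
    rw [if_neg h0] at h₅
    refine Spec.tick ?_
    have h₂' : ∀ k s, seen[k]? = some s → if s = 0 then ∀ j, j < i + 1 → l[j]? ≠ some k else
        s - 1 < i + 1 ∧ l[s - 1]? = some k := fun c s hc => by
      have := h₂ c s hc
      split_ifs at this ⊢ with h₆
      · intro j hj
        rcases Nat.lt_succ_iff_lt_or_eq.1 hj with h | rfl
        · exact this j h
        · rw [hli]
          intro h
          obtain rfl : B[j].depth = c := by simpa using h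
          rw [hseen] at hc
          exact h0 (by simpa [h₆] using hc)
      · exact ⟨by omega, this.2⟩
    by_cases hle : best.1 ≤ B[i].depth
    · rw [if_pos hle]
      refine Spec.tick ((ih (i + 1) _ _ _ (by omega) hs h₁' h₂' (.inr ⟨h₅.1, h₅.2, hli⟩) ?_).mono
        (by push_cast; omega) fun _ _ h => h)
      intro j j' c hlt hlt' hc hc'
      dsimp only
      rcases Nat.lt_succ_iff_lt_or_eq.1 hlt' with h | rfl
      · have := h₄ j j' c hlt h hc hc'
        omega
      · rw [hli] at hc'
        simp only [Option.some.injEq] at hc'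
        omega
    · rw [if_neg hle]
      refine (ih (i + 1) _ _ _ (by omega) hs h₁' h₂' h₃ ?_).mono
        (by push_cast; omega) fun _ _ h => h
      intro j j' c hlt hlt' hc hc'
      rcases Nat.lt_succ_iff_lt_or_eq.1 hlt' with h | rfl
      · exact h₄ j j' c hlt h hc hc'
      · rw [hli] at hc'
        simp only [Option.some.injEq] at hc'
        omega

theorem spec_triangularSubset {L : List Bdry} {d' : ℕ} (hw : bdrySize L < 2 ^ (d' + 1))
    (hw' : 2 ^ d' ≤ bdrySize L) : Spec I g (triangularSubset L.toArray d')
      (10 * L.length + d' + 6) (fun a _ => IsCut (depths L) d' a.1 a.2) := by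
  rw [← weight_depths] at hw hw'
  rw [triangularSubset]
  simp only [step_rules]
  refine Spec.tick ?_
  refine (spec_triangularScan (l := depths L) rfl hw hw' L.length 0 _ _ _ (by simp [depths])
    (by simp) (by simp) ?_ (.inl rfl) (by omega)).mono (by push_cast; omega) fun _ _ h => h
  intro k s hs
  rw [Array.getElem?_replicate] at hs
  split_ifs at hs with h
  rw [if_pos (by simpa using hs.symm)]
  omega

/-- Each depth is the largest one allowed by alignment and by the right end, so the greedy
decomposition is unique. -/
theorem IsBdry.depths_eq {b : ℕ} : ∀ {i : ℕ} {L L' : List Bdry}, IsBdry b i L → IsBdry b i L' →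
    depths L = depths L'
  | _, [], [], _, _ => rfl
  | i, [], x :: L', h, h' => by
    have h₁ := h.add_size
    have h₂ := h'.add_size
    have := Nat.one_le_two_pow (n := x.depth)
    simp only [bdrySize, List.map_cons, List.sum_cons, List.map_nil, List.sum_nil] at h₁ h₂
    omega
  | i, x :: L, [], h, h' => by
    have h₁ := h.add_size
    have h₂ := h'.add_size
    have := Nat.one_le_two_pow (n := x.depth)
    simp only [bdrySize, List.map_cons, List.sum_cons, List.map_nil, List.sum_nil] at h₁ h₂
    omega
  | i, x :: L, y :: L', ⟨_, _, h₁, h₂, h₃, h⟩, ⟨_, _, h₁', h₂', h₃', h'⟩ => by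
    have key : ∀ {c d : ℕ}, 2 ^ d ∣ i → i + 2 ^ d ≤ b →
        ¬ (2 ^ (c + 1) ∣ i ∧ i + 2 ^ (c + 1) ≤ b) → d ≤ c := fun {c d} h₄ h₅ h₆ => by
      by_contra! hlt
      have := Nat.pow_le_pow_right (n := 2) (by norm_num) (Nat.succ_le_of_lt hlt)
      exact h₆ ⟨(pow_dvd_pow 2 hlt).trans h₄, by rw [Nat.succ_eq_add_one] at this; omega⟩
    have heq : x.depth = y.depth := le_antisymm (key h₁ h₂ h₃') (key h₁' h₂' h₃)
    rw [← heq] at h'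
    simp only [depths, List.map_cons, List.cons.injEq]
    exact ⟨heq, h.depths_eq h'⟩

/-- When alignment imposes no restriction, only the right end limits the trees, and their sizes are
the binary digits of b − i, highest first. -/
theorem IsBdry.pairwise_gt {b : ℕ} : ∀ {i : ℕ} {L : List Bdry}, IsBdry b i L →
    (∀ j, 2 ^ j ≤ b - i → 2 ^ j ∣ i) → (depths L).Pairwise (· > ·)
  | _, [], _, _ => List.Pairwise.nil
  | i, x :: L, ⟨_, _, _, h₁, h₂, h⟩, hd => by
    have hlt : b < i + 2 ^ (x.depth + 1) := by
      by_contra! hle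
      exact h₂ ⟨hd _ (by omega), hle⟩
    refine List.Pairwise.cons (fun y hy => ?_)
      (h.pairwise_gt fun j hj => two_pow_dvd_add hd h₁ hlt hj)
    have h₃ := two_pow_le_weight hy
    have h₄ := h.add_size
    have h₅ := weight_depths L
    rw [depths] at h₅
    rw [pow_succ] at hlt
    exact (Nat.pow_lt_pow_iff_right (a := 2) (by norm_num)).1 (by omega)

/-- As long as alignment is the limiting condition, adding the tree makes the next position
divisible by a higher power of two. Once the right end becomes limiting, it stays so, and
`IsBdry.pairwise_gt` applies. -/
theorem IsBdry.unimodal {b : ℕ} : ∀ {i : ℕ} {L : List Bdry}, IsBdry b i L →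
    ∃ X Y, L = X ++ Y ∧ (depths X).Pairwise (· < ·) ∧ (depths Y).Pairwise (· > ·)
  | _, [], _ => ⟨[], [], rfl, List.Pairwise.nil, List.Pairwise.nil⟩
  | i, x :: L, hL => by
    obtain ⟨_, _, h₁, h₂, h₃, h⟩ := id hL
    by_cases hd : 2 ^ (x.depth + 1) ∣ i
    · refine ⟨[], x :: L, rfl, List.Pairwise.nil, hL.pairwise_gt fun j hj => ?_⟩
      have hlt : j < x.depth + 1 := by
        by_contra! hle
        have := Nat.pow_le_pow_right (n := 2) (by norm_num) hle
        exact h₃ ⟨hd, by omega⟩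
      exact (pow_dvd_pow 2 (Nat.le_of_lt_succ hlt)).trans h₁
    · have hd' : 2 ^ (x.depth + 1) ∣ i + 2 ^ x.depth := by
        obtain ⟨c, rfl⟩ := h₁
        rw [pow_succ] at hd ⊢
        rw [Nat.mul_dvd_mul_iff_left (by positivity)] at hd
        rw [show 2 ^ x.depth * c + 2 ^ x.depth = 2 ^ x.depth * (c + 1) by ring]
        exact mul_dvd_mul_left _ (by omega)
      by_cases hb : i + 2 ^ x.depth + 2 ^ (x.depth + 1) ≤ b
      · obtain ⟨X, Y, rfl, hX, hY⟩ := h.unimodal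
        refine ⟨x :: X, Y, rfl, ?_, hY⟩
        rcases X with _ | ⟨y, X⟩
        · exact List.pairwise_singleton _ _
        · obtain ⟨_, _, h₄, h₅, h₆, _⟩ := h
          have hxy : x.depth < y.depth := by
            by_contra! hle
            have := Nat.pow_le_pow_right (n := 2) (by norm_num) (Nat.succ_le_succ hle)
            simp only [Nat.succ_eq_add_one] at this
            exact h₆ ⟨(pow_dvd_pow 2 (Nat.succ_le_succ hle)).trans hd', by omega⟩
          refine List.Pairwise.cons (fun z hz => ?_) hX
          rcases List.mem_cons.1 hz with rfl | hz
          · exact hxy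
          · exact hxy.trans (List.rel_of_pairwise_cons hX hz)
      · refine ⟨[x], L, rfl, List.pairwise_singleton _ _, h.pairwise_gt fun j hj => ?_⟩
        have hlt : j < x.depth + 1 := by
          by_contra! hle
          have := Nat.pow_le_pow_right (n := 2) (by norm_num) hle
          omega
        exact (pow_dvd_pow 2 hlt.le).trans hd'

/-- A block is an interval, or the depths of the boundary vertices increase in its first part and
decrease in its second part. -/
structure Block.IsTriangular (K : Block) : Prop where
  a_le : K.a ≤ K.b
  b_le : K.b ≤ K.c
  c_le : K.c ≤ K.e
  depths : K.a = K.b ∨ ∃ X Y, IsBdry K.b K.a X ∧ IsBdry K.e K.c Y ∧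
    (depths X).Pairwise (· < ·) ∧ (depths Y).Pairwise (· > ·)

theorem Block.isTriangular_interval {a e : ℕ} (h : a ≤ e) : Block.IsTriangular ⟨a, a, a, e⟩ :=
  ⟨le_rfl, le_rfl, h, .inl rfl⟩

theorem Block.size_eq {K : Block} {L₁ L₂ : List Bdry} (h₁ : IsBdry K.b K.a L₁)
    (h₂ : IsBdry K.e K.c L₂) : bdrySize (L₁ ++ L₂) = K.size := by
  have h₃ := h₁.add_size
  have h₄ := h₂.add_size
  rw [bdrySize_append, Block.size]
  omega

theorem Block.IsTriangular.remove {K : Block} (hK : K.IsTriangular) {L₁ L₂ : List Bdry}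
    (h₁ : IsBdry K.b K.a L₁) (h₂ : IsBdry K.e K.c L₂) {d' j₀ j₁ : ℕ}
    (hw : K.size < 2 ^ (d' + 1)) (hj : IsCut (AndOr.depths (L₁ ++ L₂)) d' j₀ j₁) :
    ∃ A M C a b c, L₁ ++ L₂ = A ++ M ++ C ∧ A.length = j₀ ∧ M.length = j₁ + 1 - j₀ ∧ j₀ ≤ j₁ ∧
      IsBdry b a A ∧ IsBdry K.e c C ∧ a ≤ b ∧ b ≤ c ∧ c ≤ K.e ∧
      (AndOr.depths A).Pairwise (· < ·) ∧ (AndOr.depths C).Pairwise (· > ·) ∧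
      2 * (bdrySize A + bdrySize C) ≤ K.size := by
  -- For an interval, the peak lies somewhere within the second part of the block; otherwise it lies
  -- at the gap between the two parts.
  obtain ⟨X, Y, hXY, hX, hY, hor⟩ : ∃ X Y, L₁ ++ L₂ = X ++ Y ∧
      (AndOr.depths X).Pairwise (· < ·) ∧ (AndOr.depths Y).Pairwise (· > ·) ∧
      (X = L₁ ∧ Y = L₂ ∨ L₁ = []) := by
    rcases hK.depths with h | ⟨X, Y, hX, hY, hX', hY'⟩
    · obtain rfl : L₁ = [] := by
        have h₃ := h₁.add_size
        have h₄ := length_le_bdrySize L₁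
        exact List.length_eq_zero_iff.1 (by omega)
      obtain ⟨X, Y, rfl, hX, hY⟩ := h₂.unimodal
      exact ⟨X, Y, rfl, hX, hY, .inr rfl⟩
    · exact ⟨L₁, L₂, rfl, by rwa [h₁.depths_eq hX], by rwa [h₂.depths_eq hY], .inl ⟨rfl, rfl⟩⟩
  have hsz := Block.size_eq h₁ h₂
  have hmap : AndOr.depths (L₁ ++ L₂) = AndOr.depths X ++ AndOr.depths Y := by
    rw [hXY, AndOr.depths, List.map_append]
    rfl
  rw [← hsz, ← weight_depths, hmap] at hw
  rw [hmap] at hj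
  obtain ⟨h₃, h₄, h₅, h₆, h₇⟩ := hj.weight_le hX hY hw
  rw [← hmap, weight_depths, hsz] at h₇
  rw [← hmap] at h₄
  simp only [AndOr.depths, List.length_map] at h₄ h₅ h₆ h₇
  rw [← List.map_take, ← List.map_drop] at h₇
  change 2 * (weight (AndOr.depths _) + weight (AndOr.depths _)) ≤ _ at h₇
  rw [weight_depths, weight_depths] at h₇
  set A := (L₁ ++ L₂).take j₀ with hA
  set C := (L₁ ++ L₂).drop (j₁ + 1) with hC
  set M := ((L₁ ++ L₂).take (j₁ + 1)).drop j₀ with hM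
  have hAM : A ++ M = (L₁ ++ L₂).take (j₁ + 1) := by
    rw [hM, hA, ← min_eq_left (by omega : j₀ ≤ j₁ + 1), ← List.take_take,
      min_eq_left (by omega : j₀ ≤ j₁ + 1), List.take_append_drop]
  have hAMC : L₁ ++ L₂ = A ++ M ++ C := by rw [hAM, List.take_append_drop]
  have hAX : A = X.take j₀ := by rw [hA, hXY, List.take_append_of_le_length h₅]
  have hCY : C = Y.drop (j₁ + 1 - X.length) := by
    rw [hC, hXY, List.drop_append, List.drop_eq_nil_of_le h₆, List.nil_append]
  have hA' : (AndOr.depths A).Pairwise (· < ·) := by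
    rw [hAX, AndOr.depths, List.map_take]
    exact hX.sublist (List.take_sublist _ _)
  have hC' : (AndOr.depths C).Pairwise (· > ·) := by
    rw [hCY, AndOr.depths, List.map_drop]
    exact hY.sublist (List.drop_sublist _ _)
  have hlA : A.length = j₀ := by
    rw [hA, List.length_take]
    omega
  have hlM : M.length = j₁ + 1 - j₀ := by
    rw [hM, List.length_drop, List.length_take]
    omega
  rcases hor with ⟨rfl, rfl⟩ | rfl
  · have h₈ : IsBdry K.b K.a (A ++ X.drop j₀) := by rwa [hAX, List.take_append_drop]
    have h₉ : IsBdry K.e K.c (Y.take (j₁ + 1 - X.length) ++ C) := by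
      rwa [hCY, List.take_append_drop]
    obtain ⟨h₁₀, h₁₁⟩ := h₈.prefix
    obtain ⟨-, h₁₂⟩ := h₉.prefix
    have := h₁₁.add_size
    have := h₁₂.add_size
    have := hK.b_le
    exact ⟨A, M, C, _, _, _, hAMC, hlA, hlM, h₃, h₁₀, h₁₂, by omega, by omega, by omega, hA', hC',
      h₇⟩
  -- In an interval, both remaining pieces come from the same sequence, and removing the middle
  -- creates the gap.
  · rw [List.nil_append] at hAMC
    rw [hAMC, List.append_assoc] at h₂
    obtain ⟨h₁₀, h₁₁⟩ := h₂.prefix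
    obtain ⟨-, h₁₂⟩ := h₁₁.prefix
    have := h₁₂.add_size
    exact ⟨A, M, C, _, _, _, by rw [List.nil_append, hAMC], hlA, hlM, h₃, h₁₀, h₁₂, by omega,
      by omega, by omega, hA', hC', h₇⟩

/-- The end of the block must be preserved because the position e belongs to t_j, which later joins
the symmetric inputs. An empty left piece turns the block into an interval. -/
theorem spec_remainder {A M C : List Bdry} {a b c e j₀ j₁ : ℕ} (hA : A.length = j₀)
    (hM : M.length = j₁ + 1 - j₀) (hj : j₀ ≤ j₁) (h₁ : IsBdry b a A) (h₂ : IsBdry e c C)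
    (hab : a ≤ b) (hbc : b ≤ c) (hce : c ≤ e) (hA' : (depths A).Pairwise (· < ·))
    (hC' : (depths C).Pairwise (· > ·)) :
    Spec I g (remainder (A ++ M ++ C).toArray e j₀ j₁) 9 (fun R _ => R.IsTriangular ∧ R.e = e ∧
      R.size = bdrySize A + bdrySize C) := by
  have hs₁ := h₁.add_size
  have hs₂ := h₂.add_size
  have key : ∀ t : ℤ, 4 ≤ t → Spec I g ((if j₀ = 0 then pure ⟨c, c, c, e⟩ else
      read (A ++ M ++ C).toArray 0 >>= fun x => tick 1
        (read (A ++ M ++ C).toArray (j₀ - 1) >>= fun y => tick 1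
          (pure ⟨x.left, y.right + 1, c, e⟩))) : RAM Block)
      t (fun R _ => R.IsTriangular ∧ R.e = e ∧ R.size = bdrySize A + bdrySize C) := by
    intro t ht
    split_ifs with h0
    · obtain rfl : A = [] := List.length_eq_zero_iff.1 (by omega)
      refine spec_pure.2 ⟨by omega, Block.isTriangular_interval hce, rfl, ?_⟩
      simp only [Block.size, bdrySize, List.map_nil, List.sum_nil] at hs₂ ⊢
      omega
    · obtain ⟨A', y, rfl⟩ := (List.eq_nil_or_concat' A).resolve_left
        (fun h => h0 (by rw [← hA, h]; rfl))
      rw [List.length_append, List.length_singleton] at hA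
      obtain ⟨x, A'', hx⟩ : ∃ x A'', A' ++ [y] = x :: A'' :=
        List.exists_cons_of_ne_nil (by simp)
      have hr₁ : (A' ++ [y] ++ M ++ C).toArray[0]? = some x := by
        rw [hx]
        simp
      have hr₂ : (A' ++ [y] ++ M ++ C).toArray[j₀ - 1]? = some y := by
        simp [show j₀ - 1 = A'.length by omega]
      rw [read_eq hr₁]
      simp only [step_rules]
      rw [read_eq hr₂]
      simp only [step_rules]
      have hxa : x.left = a := by
        rw [hx] at h₁
        exact h₁.1
      have hyb : y.right + 1 = b := by
        obtain ⟨-, _, h₃, _, _, _, h₄⟩ := h₁.prefix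
        rw [h₃]
        exact h₄
      rw [hxa, hyb]
      refine Spec.tick (spec_pure.2 ⟨by push_cast; omega, ⟨hab, hbc, hce, .inr
        ⟨_, _, h₁, h₂, hA', hC'⟩⟩, rfl, ?_⟩)
      simp only [Block.size]
      omega
  rw [remainder]
  simp only [step_rules]
  refine Spec.tick ?_
  rcases C with _ | ⟨z, C⟩
  · obtain rfl : c = e := h₂
    rw [if_neg (by simp; omega)]
    exact Spec.tick (key _ (by simp))
  · have hz : (A ++ M ++ z :: C).toArray[j₁ + 1]? = some z := by
      rw [List.getElem?_toArray, List.getElem?_append_right (by simp; omega)]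
      simp [show j₁ + 1 - (A.length + M.length) = 0 by omega]
    rw [if_pos (by simp; omega), read_eq hz]
    simp only [step_rules]
    refine Spec.tick ?_
    rw [h₂.1]
    exact key _ (by simp)

/-! ## The recursion -/

/-- The condition `m ≤ μ (d, n)` for `ξ = p / q`, in the form tested by the algorithm. -/
def LeMu (p q m d n : ℕ) : Prop := q * ((m - 2) * d) ≤ p * (2 ^ d - (n + 2))

instance (p q m d n : ℕ) : Decidable (LeMu p q m d n) := by
  unfold LeMu
  infer_instance

theorem leMu_eq (E : Env) (m d n : ℕ) :
    leMu E m d (2 ^ d) n = tick 7 (pure (decide (LeMu E.p E.q m d n))) := by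
  simp only [leMu, step_rules, LeMu]

theorem spec_dMin (E : Env) (n m d₁ : ℕ) (h₁ : LeMu E.p E.q m d₁ n) : ∀ (k g d : ℕ), d + k = d₁ →
    (∀ d', d ≤ d' → d' < d₁ → ¬ LeMu E.p E.q m d' n) →
    Spec I g (dMin E n m d (2 ^ d)) (9 * k + 7) (fun a _ => a = (d₁, 2 ^ d₁)) := by
  intro k
  induction k with
  | zero =>
    intro g d hd h
    obtain rfl : d = d₁ := hd
    rw [dMin]
    simp only [leMu_eq, step_rules]
    refine Spec.tick ?_
    rw [if_pos h₁, spec_pure]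
    exact ⟨by simp, rfl⟩
  | succ k ih =>
    intro g d hd h
    rw [dMin]
    simp only [leMu_eq, step_rules]
    refine Spec.tick ?_
    rw [if_neg (h d le_rfl (by omega)), ← pow_succ]
    exact Spec.tick ((ih _ _ (by omega) fun d' h₂ h₃ => h d' (by omega) h₃).mono
      (by push_cast; omega) fun _ _ h => h)

/-- Rounding down the quotient gives an integer y with y + 2 ≤ μ(d,n). Since m itself is not
admissible, y + 2 < m, so the odd prefix is proper. -/
theorem spec_oddPrefix (E : Env) {m d n : ℕ} (hq : 1 ≤ E.q) (hd : 1 ≤ d) (hm : 3 ≤ m)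
    (h : ¬ LeMu E.p E.q m d n) : Spec I g (oddPrefix E d (2 ^ d) n) 12 (fun k _ =>
      k % 2 = 1 ∧ k < m ∧ (k ≤ 2 ∨ LeMu E.p E.q k d n)) := by
  rw [oddPrefix]
  simp only [step_rules]
  refine Spec.tick ?_
  split_ifs with hle
  · refine Spec.tick (spec_pure.2 ⟨by simp, ?_⟩)
    rw [LeMu, not_le] at h
    have h₁ : E.p * (2 ^ d - (n + 2)) / (E.q * d) < m - 2 := by
      rw [Nat.div_lt_iff_lt_mul (by positivity)]
      calc _ < _ := h
        _ = _ := by ring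
    have h₂ := Nat.div_mul_le_self (E.p * (2 ^ d - (n + 2))) (E.q * d)
    generalize E.p * (2 ^ d - (n + 2)) / (E.q * d) = y at h₁ h₂ ⊢
    refine ⟨by omega, by omega, .inr ?_⟩
    rw [LeMu]
    calc _ ≤ E.q * (y * d) := by gcongr; omega
      _ = y * (E.q * d) := by ring
      _ ≤ _ := h₂
  · rw [spec_pure]
    exact ⟨by simp, by simp, by omega, .inl (by simp)⟩

/-- The precomputed data are those for `M` alternating inputs, and `p / q ≤ 2`. -/
structure Env.IsCorrect (E : Env) (M : ℕ) : Prop where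
  one_le_q : 1 ≤ E.q
  p_le : E.p ≤ 2 * E.q
  lg : IsLogTable E.lg (E.n + M)
  even : E.evenData.IsCorrect (E.n + (M + 1) / 2)
  odd : E.oddData.IsCorrect (M / 2)

/-- The position `e` of `t_j` in the leftist circuit given by `side`. -/
def Env.IsPosition (E : Env) (side : Bool) (j e : ℕ) : Prop :=
  if side then j % 2 = 0 ∧ e = E.n + j / 2 else j % 2 = 1 ∧ e = j / 2

/-! ### The potential and its decrease under the three splits -/

/-- An upper bound for the cost of the recursion on `n` symmetric and `m` alternating inputs,
if `m ≤ μ (d, n)`. -/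
def bound (n m d : ℕ) : ℤ :=
  200 * n + 200 * (d + 1) * (4 * m - 3 + (min n 1 : ℕ)) + 200 * m * d

theorem le_bound (n d : ℕ) {m : ℕ} (hm : 1 ≤ m) : 200 * n + 200 * (d + 1) ≤ bound n m d := by
  have h₁ : (0 : ℤ) ≤ (d + 1) * (4 * m - 4 + (min n 1 : ℕ)) :=
    mul_nonneg (by positivity) (by omega)
  have h₂ : (0 : ℤ) ≤ m * d := by positivity
  rw [bound]
  linarith

theorem bound_mono (n : ℕ) {m d d' : ℕ} (hm : 1 ≤ m) (hd : d ≤ d') :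
    bound n m d ≤ bound n m d' := by
  have h : (0 : ℤ) ≤ 4 * m - 3 + (min n 1 : ℕ) := by omega
  rw [bound, bound]
  gcongr

theorem bound_symmetric (d : ℕ) {n n' m : ℕ} (hn : 2 * n' ≤ n) :
    bound n' m d + 100 * n ≤ bound n m d := by
  have h₁ : (0 : ℤ) ≤ (d + 1) * ((min n 1 : ℕ) - (min n' 1 : ℕ)) :=
    mul_nonneg (by positivity) (by omega)
  rw [bound, bound]
  have : (2 * n' : ℤ) ≤ n := by exact_mod_cast hn
  linarith

theorem bound_simple {n m d : ℕ} (hn : 1 ≤ n) (hm : 1 ≤ m) :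
    bound 0 m (d - 1) + 200 * n + 200 * (d + 1) ≤ bound n m d := by
  refine le_trans (add_le_add_left (add_le_add_left (bound_mono 0 hm (Nat.sub_le d 1)) _) _) ?_
  simp only [bound, min_eq_right hn]
  push_cast
  simp
  linarith

theorem bound_alternating (n : ℕ) {k m d : ℕ} (hk : 1 ≤ k) (hd : 1 ≤ d) :
    bound n k (d - 1) + bound (k / 2) m d + 400 * (d + 1) ≤ bound n (k + m) d := by
  obtain ⟨d, rfl⟩ := Nat.exists_eq_add_of_le' hd
  have h₁ : (0 : ℤ) ≤ 4 * k - 3 + (min n 1 : ℕ) := by omega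
  -- The second occurrence of −3 frees three units of 200(d+1) (here d is shifted by one): two cover
  -- the local steps, the third the possible increase of min(⌊k/2⌋,1).
  have h₂ : (0 : ℤ) ≤ (d + 2) * (1 - (min (k / 2) 1 : ℕ)) := mul_nonneg (by positivity) (by omega)
  have h₃ : (2 * (k / 2 : ℕ) : ℤ) ≤ k := by omega
  rw [Nat.add_sub_cancel]
  simp only [bound]
  push_cast at h₁ h₂ h₃ ⊢
  linarith

/-- Passing from m to m − k lowers the left-hand side by qkd, whereas ⌊k/2⌋ symmetric inputs lower
the right-hand side by at most p⌊k/2⌋ ≤ qk. So the depth need not grow. -/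
theorem LeMu.right {p q m d n k : ℕ} (hp : p ≤ 2 * q) (hd : 1 ≤ d) (h : LeMu p q m d n)
    (hk : k % 2 = 1) : m - k ≤ 2 ∨ LeMu p q (m - k) d (k / 2) := by
  rcases Nat.lt_or_ge 2 (m - k) with hm | hm
  · right
    obtain ⟨y, rfl⟩ : ∃ y, k = 2 * y + 1 := ⟨k / 2, by omega⟩
    obtain ⟨x, rfl⟩ : ∃ x, m = x + 3 + (2 * y + 1) := ⟨m - 3 - (2 * y + 1), by omega⟩
    rw [LeMu] at h ⊢
    rw [show x + 3 + (2 * y + 1) - 2 = x + 1 + (2 * y + 1) by omega] at h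
    rw [show x + 3 + (2 * y + 1) - (2 * y + 1) - 2 = x + 1 by omega,
      show (2 * y + 1) / 2 = y by omega]
    have h₁ : p * (2 ^ d - (n + 2)) ≤ p * (2 ^ d - (y + 2)) + p * y := by
      rw [← Nat.mul_add]
      exact Nat.mul_le_mul_left _ (by omega)
    have h₂ : p * y ≤ q * ((2 * y + 1) * d) := by
      calc p * y ≤ 2 * q * y := Nat.mul_le_mul_right _ hp
        _ = q * (2 * y * 1) := by ring
        _ ≤ _ := by gcongr; omega
    rw [Nat.add_mul, Nat.mul_add] at h
    omega
  · exact .inl hm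

theorem Env.IsPosition.alternating {E : Env} {side : Bool} {j e k : ℕ}
    (h : E.IsPosition side j e) (hk : k % 2 = 1) :
    E.IsPosition (!side) (j + k) ((if side = true then (j + 1) / 2 else E.n + (j + 1) / 2) + k / 2) := by
  cases side <;> simp only [Env.IsPosition, Bool.not_false, Bool.not_true, if_true, if_false,
    Bool.false_eq_true] at h ⊢ <;> omega

theorem spec_grin {E : Env} {M : ℕ} (hE : E.IsCorrect M) : ∀ (m n g d j : ℕ) (side : Bool)
    (K : Block), K.size = n → K.IsTriangular → E.IsPosition side j K.e → 1 ≤ m → j + m ≤ M →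
    (m ≤ 2 ∨ 1 ≤ d ∧ LeMu E.p E.q m d n) →
    Spec I g (grin E side K j m) (bound n m d) (fun _ _ => True) := by
  intro m
  induction m using Nat.strong_induction_on with
  | _ m ihm =>
  intro n
  induction n using Nat.strong_induction_on with
  | _ n ihn =>
  intro g d₂ j side K hn hK hpos hm hj hd₂
  -- Here r is the number of inputs of the leftist circuit in use; t_j is one of them, so the block
  -- stays within range even after t_j is added.
  obtain ⟨r, hD, hrN, her⟩ : ∃ r, (if side = true then E.evenData else E.oddData).IsCorrect r ∧
      r ≤ E.n + M ∧ K.e + 1 ≤ r := by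
    cases side
    · simp only [Env.IsPosition, Bool.false_eq_true, if_false] at hpos
      exact ⟨_, hE.odd, by omega, by omega⟩
    · simp only [Env.IsPosition, if_true] at hpos
      exact ⟨_, hE.even, by omega, by omega⟩
  have ha := hK.a_le
  have hb := hK.b_le
  have hc := hK.c_le
  have hB : ∀ g, Spec I g (bdry (if side = true then E.evenData else E.oddData) E.lg
      ⟨K.a, K.b, K.c, K.e + 1⟩) (10 * n + 13) (fun B _ => 1 ≤ B.size ∧ B.size ≤ n + 1) := by
    intro g
    refine (spec_bdry hD hE.lg hrN (by exact ha) (by dsimp only; omega) (by dsimp only; omega)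
      (by exact her)).mono ?_ ?_
    · rw [← hn]
      simp only [Block.size]
      push_cast
      omega
    · rintro B g' ⟨L₁, L₂, rfl, h₁, h₂⟩
      have h₃ := length_le_bdrySize (L₁ ++ L₂)
      rw [Block.size_eq (K := ⟨K.a, K.b, K.c, K.e + 1⟩) h₁ h₂] at h₃
      rw [Block.size] at h₃ hn
      dsimp only at h₁ h₂ h₃
      rw [List.size_toArray]
      refine ⟨?_, by omega⟩
      rcases L₂ with _ | ⟨x, L₂⟩
      · have : K.c = K.e + 1 := h₂
        omega
      · simp
        omega
  have hleaf : ∀ (g : ℕ) (B : Array Bdry) (L : Array Item), 1 ≤ B.size ∧ B.size ≤ n + 1 →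
      L.size ≤ 2 → Spec I g (symTree side B 0 B.size L) (45 * n + 121) (fun _ _ => True) :=
    fun g B L h h' => (spec_symTree side B 0 B.size L (by omega) le_rfl (by omega)).mono
      (by push_cast; omega) fun _ _ h => h
  have hle := le_bound n d₂ hm
  rw [grin]
  simp only [step_rules, blockSize]
  refine Spec.tick ?_
  by_cases hm1 : m = 1
  · rw [if_pos hm1]
    refine (hB _).bind fun B g' h => Spec.tick ?_
    exact (hleaf _ _ _ h (by simp)).mono (by push_cast; omega) fun _ _ h => h
  rw [if_neg hm1]
  refine Spec.tick ?_
  by_cases hm2 : m = 2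
  · rw [if_pos hm2]
    refine (hB _).bind fun B g' h => Spec.tick ?_
    exact (hleaf _ _ _ h (by simp)).mono (by push_cast; omega) fun _ _ h => h
  rw [if_neg hm2]
  refine Spec.tick ?_
  rw [show K.b - K.a + (K.e - K.c) = n from hn]
  change Spec _ _ (dMin E n m 1 (2 ^ 1) >>= _) _ _
  -- The depth d₂ is only an admissible upper bound; the program finds the least depth d, and the
  -- potential is monotone in it.
  obtain ⟨d, hd₁, hd, hdd, hmin⟩ : ∃ d, 1 ≤ d ∧ LeMu E.p E.q m d n ∧ d ≤ d₂ ∧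
      ∀ d', 1 ≤ d' → d' < d → ¬ LeMu E.p E.q m d' n := by
    have hex : ∃ d, 1 ≤ d ∧ LeMu E.p E.q m d n := ⟨d₂, hd₂.resolve_left (by omega)⟩
    exact ⟨Nat.find hex, (Nat.find_spec hex).1, (Nat.find_spec hex).2,
      Nat.find_min' hex (hd₂.resolve_left (by omega)),
      fun d' h₁ h₂ h₃ => Nat.find_min hex h₂ ⟨h₁, h₃⟩⟩
  have hdb := bound_mono n hm hdd
  replace hle := le_bound n d hm
  -- For m ≥ 3 the left-hand side of the test is positive, so the truncated difference on the right
  -- cannot vanish.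
  have h2 : n + 2 < 2 ^ d := by
    by_contra! h
    rw [LeMu, Nat.sub_eq_zero_of_le h, Nat.mul_zero, Nat.le_zero] at hd
    have := hE.one_le_q
    have : 0 < E.q * ((m - 2) * d) := Nat.mul_pos (by omega) (Nat.mul_pos (by omega) (by omega))
    omega
  refine (spec_dMin E n m d hd (d - 1) _ 1 (by omega) hmin).bind ?_
  rintro a g' rfl
  dsimp only
  refine Spec.tick ?_
  by_cases hd3 : d ≤ 3
  · rw [if_pos hd3]
    refine (hB _).bind fun B g' h => Spec.tick ?_
    by_cases hm3 : m = 3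
    · rw [if_pos hm3]
      refine (spec_newGate _ _ _).bind fun u g' _ => Spec.tick ?_
      exact (hleaf _ _ _ h (by simp)).mono (by push_cast; omega) fun _ _ h => h
    rw [if_neg hm3]
    refine Spec.tick ?_
    by_cases hm4 : m = 4
    · rw [if_pos hm4]
      refine (spec_newGate _ _ _).bind fun u g' _ => ?_
      refine (spec_newGate _ _ _).bind fun u g' _ => Spec.tick ?_
      exact (hleaf _ _ _ h (by simp)).mono (by push_cast; omega) fun _ _ h => h
    · rw [if_neg hm4]
      refine Spec.tick ?_
      refine (spec_newGate _ _ _).bind fun u g' _ => ?_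
      refine (spec_newGate _ _ _).bind fun u g' _ => ?_
      refine (spec_newGate _ _ _).bind fun u g' _ => Spec.tick ?_
      exact (hleaf _ _ _ h (by simp)).mono (by push_cast; omega) fun _ _ h => h
  rw [if_neg hd3]
  refine Spec.tick ?_
  have hpow : 2 ^ d / 2 = 2 ^ (d - 1) := by
    obtain ⟨c, rfl⟩ := Nat.exists_eq_add_of_le' hd₁
    rw [pow_succ, Nat.add_sub_cancel, Nat.mul_div_cancel _ (by norm_num)]
  rw [hpow]
  have hBK : ∀ g, Spec I g (bdry (if side = true then E.evenData else E.oddData) E.lg K)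
      (10 * n + 3) (fun B _ => ∃ L₁ L₂ : List Bdry, B = (L₁ ++ L₂).toArray ∧
        IsBdry K.b K.a L₁ ∧ IsBdry K.e K.c L₂) := by
    intro g
    rw [← hn]
    exact spec_bdry hD hE.lg hrN ha (by omega) hc (by omega)
  by_cases hsym : 2 ^ (d - 1) ≤ n
  · rw [if_pos hsym]
    refine (hBK _).bind ?_
    rintro B g' ⟨L₁, L₂, rfl, h₁, h₂⟩
    have hsz := Block.size_eq h₁ h₂
    have hlen := length_le_bdrySize (L₁ ++ L₂)
    have hlt : n < 2 ^ (d - 1 + 1) := by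
      rw [Nat.sub_add_cancel hd₁]
      omega
    refine (spec_triangularSubset (by omega) (by omega)).bind ?_
    rintro ⟨j₀, j₁⟩ g' h₃
    dsimp only at h₃ ⊢
    obtain ⟨A, M', C, a, b, c, h₄, h₅, h₆, h₇, h₈, h₉, h₁₀, h₁₁, h₁₂, h₁₃, h₁₄, h₁₅⟩ :=
      hK.remove h₁ h₂ (by omega) h₃
    have hlen' := congrArg List.length h₄
    simp only [List.length_append] at hlen' hlen
    refine Spec.tick ?_
    refine (spec_symTree side _ j₀ (j₁ + 1) _ (by omega) (by simp; omega) (by omega)).bind ?_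
    intro u g' _
    rw [h₄]
    refine (spec_remainder h₅ h₆ h₇ h₈ h₉ h₁₀ h₁₁ h₁₂ h₁₃ h₁₄).bind ?_
    rintro R g' ⟨h₁₆, h₁₇, h₁₈⟩
    -- Fewer symmetric inputs only enlarge μ, so d remains admissible.
    refine (ihn R.size (by omega) g' d j side R rfl h₁₆ (by rwa [h₁₇]) hm hj
      (.inr ⟨hd₁, hd.trans (Nat.mul_le_mul_left _ (by omega))⟩)).bind ?_
    intro v g' _
    refine (spec_newGate _ _ _).mono ?_ fun _ _ _ => trivial
    have h₁₉ := bound_symmetric d (m := m) (show 2 * R.size ≤ n by omega)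
    have h₂₀ := Nat.lt_two_pow_self (n := d - 1)
    have h₂₁ := Nat.pow_le_pow_right (n := 2) (by norm_num) (show 3 ≤ d - 1 by omega)
    have h₂₂ : (A ++ M' ++ C).length ≤ n := by
      rw [← h₄, List.length_append]
      omega
    push_cast
    simp only [Array.size_replicate]
    omega
  rw [if_neg hsym]
  simp only [leMu_eq, step_rules]
  refine Spec.tick ?_
  by_cases hsimple : LeMu E.p E.q m (d - 1) 0
  -- For n = 0 the test for a simple split would contradict the minimality of d.
  · have hn1 : 1 ≤ n := by
      by_contra! h0
      exact hmin (d - 1) (by omega) (by omega) (by rwa [show n = 0 by omega])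
    rw [if_pos hsimple]
    refine (hBK _).bind ?_
    rintro B g' ⟨L₁, L₂, rfl, h₁, h₂⟩
    have hsz := Block.size_eq h₁ h₂
    have hlen := length_le_bdrySize (L₁ ++ L₂)
    have hpos' : (L₁ ++ L₂).length ≠ 0 := fun h => by
      rw [List.length_eq_zero_iff.1 h] at hsz
      simp only [bdrySize, List.map_nil, List.sum_nil] at hsz
      omega
    refine Spec.tick ?_
    refine (spec_symTree side _ 0 _ _ (by omega) le_rfl
      (by rw [List.size_toArray]; omega)).bind ?_
    intro u g' _
    refine (ihn 0 (by omega) g' (d - 1) j side ⟨K.e, K.e, K.e, K.e⟩ (by simp [Block.size])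
      (Block.isTriangular_interval le_rfl) hpos hm hj (.inr ⟨by omega, hsimple⟩)).bind ?_
    intro v g' _
    refine (spec_newGate _ _ _).mono ?_ fun _ _ _ => trivial
    have h₁₉ := bound_simple (d := d) hn1 hm
    simp only [Array.size_replicate, List.size_toArray]
    push_cast
    omega
  rw [if_neg hsimple]
  -- Minimality of d excludes m ≤ μ(d−1,n); this is what makes k < m and both calls smaller.
  refine (spec_oddPrefix E hE.one_le_q (by omega) (by omega)
    (hmin (d - 1) (by omega) (by omega))).bind ?_
  rintro k g' ⟨hk₁, hk₂, hk₃⟩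
  refine (ihm k hk₂ n g' (d - 1) j side K hn hK hpos (by omega) (by omega)
    (hk₃.imp_right fun h => ⟨by omega, h⟩)).bind ?_
  intro u g' _
  have hright := hd.right hE.p_le hd₁ hk₁
  have hpos' := hpos.alternating hk₁
  have hbound := bound_alternating n (k := k) (m := m - k) (by omega) hd₁
  rw [Nat.add_sub_cancel' hk₂.le] at hbound
  refine Spec.tick ?_
  have key : ∀ (g c : ℕ) (t : ℤ),
      E.IsPosition (!side) (j + k) (c + k / 2) → bound (k / 2) (m - k) d + 2 ≤ t →
      Spec I g (grin E (!side) ⟨c, c, c, c + k / 2⟩ (j + k) (m - k) >>= fun v =>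
        newGate side u v) t (fun _ _ => True) := by
    intro g c t h₁ h₂
    refine (ihm (m - k) (by omega) (k / 2) g d (j + k) (!side) _ (by simp [Block.size])
      (Block.isTriangular_interval (by omega)) h₁ (by omega) (by omega)
      (hright.imp_right fun h => ⟨hd₁, h⟩)).bind fun v g' _ => ?_
    exact (spec_newGate _ _ _).mono (by omega) fun _ _ _ => trivial
  by_cases hside : side = true
  · rw [if_pos hside] at hpos' ⊢
    exact Spec.tick (key _ _ _ hpos' (by push_cast; omega))
  · rw [if_neg hside] at hpos' ⊢
    exact Spec.tick (key _ _ _ hpos' (by push_cast; omega))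

/-! ## The whole algorithm -/

theorem spec_gateCount : Spec I g gateCount 1 (fun a g' => a = g ∧ g' = g) := by
  rintro G t rfl
  exact ⟨_, _, _, rfl, by push_cast; omega, rfl, rfl⟩

theorem spec_andOrPath {ξ : ℚ} {n m d : ℕ} (hp : ξ.num.toNat ≤ 2 * ξ.den) (hm : 1 ≤ m)
    (hd : 1 ≤ d) (hmu : LeMu ξ.num.toNat ξ.den m d n) :
    Spec (n + m) 0 (andOrPath ξ n m) (40 * (n + m) + 60 + bound n m d) (fun _ _ => True) := by
  rw [andOrPath]
  simp only [step_rules]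
  refine Spec.tick ?_
  refine (spec_logTable (n + m + 1) (n + m) 2 (Array.replicate 2 0) (by omega) le_rfl (by simp)
    fun j h₁ h₂ => ?_).bind ?_
  · obtain rfl : j = 1 := by omega
    simp
  rintro lg g' ⟨hlg, rfl⟩
  refine Spec.tick ?_
  refine (spec_range 1 n le_rfl n 0 _ (by omega)).bind ?_
  rintro A g' ⟨rfl, hA, -, hA'⟩
  refine (spec_range 2 (n + m) (by norm_num) m n A (by omega)).bind ?_
  rintro ins g' ⟨rfl, hs, hi, hi'⟩
  refine Spec.tick ?_
  refine (spec_range 2 (n + m) (by norm_num) m (n + 1) _ (by omega)).bind ?_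
  rintro ins' g' ⟨rfl, hs', -, hi''⟩
  simp only [Array.size_replicate, Nat.zero_add, Nat.sub_zero, Nat.div_one, Nat.add_sub_cancel,
    Nat.one_mul] at hA hA' hi'' hs'
  rw [hA] at hs hi hi'
  replace hs : ins.size = n + (m + 1) / 2 := by omega
  replace hs' : ins'.size = m / 2 := by omega
  have hV : ins.size + ins'.size = n + m := by omega
  refine Spec.tick ?_
  -- The ghost function maps each input vertex to its position: s_i to i, and t_i with i even to n +
  -- i/2. Its values at odd i are irrelevant here.
  refine (spec_leftist true lg ins (fun j h₁ h₂ => hlg j h₁ (by omega)) ins.size 0 _ _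
    (fun v => if v < n then v else n + (v - n) / 2) (by omega) (by simp) fun j v hv => ?_).bind ?_
  · have hj := (Array.getElem?_eq_some_iff.1 hv).1
    rcases Nat.lt_or_ge j n with h | h
    · rw [hi j h, hA' j h] at hv
      obtain rfl : j = v := by simpa using hv
      exact ⟨by omega, if_pos h⟩
    · obtain ⟨l, rfl⟩ := Nat.exists_eq_add_of_le h
      rw [hi' l (by omega)] at hv
      obtain rfl : n + 2 * l = v := by simpa using hv
      refine ⟨by omega, ?_⟩
      rw [if_neg (by omega)]
      omega
  rintro S g₁ ⟨-, hg₁, ρ, L, -, hL, hF⟩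
  refine Spec.tick ?_
  refine (spec_leftist false lg ins' (fun j h₁ h₂ => hlg j h₁ (by omega)) ins'.size 0 _ _
    (fun v => (v - (n + 1)) / 2) (by omega) (by simp) fun j v hv => ?_).bind ?_
  · have hj := (Array.getElem?_eq_some_iff.1 hv).1
    rw [hi'' j (by omega)] at hv
    obtain rfl : n + 1 + 2 * j = v := by simpa using hv
    exact ⟨by omega, by omega⟩
  rintro S' g₂ ⟨hg₂, hg₂', ρ', L', -, hL', hF'⟩
  rw [Array.replicate_zero, Array.empty_append] at hL hL'
  subst hL hL'
  refine spec_gateCount.bind ?_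
  rintro _ _ ⟨rfl, rfl⟩
  rename_i g₂
  refine Spec.tick ?_
  refine (spec_precompute (hF.mono (by omega) fun _ _ => rfl)).bind ?_
  rintro D g' ⟨rfl, hD⟩
  refine (spec_precompute hF').bind ?_
  rintro D' g' ⟨rfl, hD'⟩
  rw [hs] at hD
  rw [hs'] at hD'
  have hE : Env.IsCorrect ⟨ξ.num.toNat, ξ.den, n, lg, D, D'⟩ m :=
    ⟨ξ.den_pos, hp, fun j h₁ h₂ => hlg j h₁ (h₂.trans (Nat.le_succ _)), hD, hD'⟩
  refine (spec_grin hE m n _ d 0 true ⟨0, 0, 0, n⟩ (by simp [Block.size])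
    (Block.isTriangular_interval (by omega)) (by simp [Env.IsPosition]) hm (by omega)
    (.inr ⟨hd, hmu⟩)).mono ?_ fun _ _ h => h
  push_cast
  omega

/-! ### Logarithmic depth and the final estimate -/

/-- With l = ⌊log₂(n+m)⌋, the factor n + m is below 2^(l+1) and 2l + 4 is at most 2^(l+2), so (n+m)d
≤ 2^d for d = 2l + 4. -/
theorem leMu_of_log {p q n m : ℕ} (hqp : q ≤ p) (hm : 1 ≤ m) :
    LeMu p q m (2 * Nat.log 2 (n + m) + 4) n := by
  have hlt : n + m < 2 ^ (Nat.log 2 (n + m) + 1) := Nat.lt_pow_succ_log_self (by norm_num) _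
  generalize Nat.log 2 (n + m) = l at *
  have hl : l + 1 < 2 ^ (l + 1) := Nat.lt_two_pow_self
  have h : (n + m) * (2 * l + 4) ≤ 2 ^ (2 * l + 4) := by
    calc (n + m) * (2 * l + 4) ≤ 2 ^ (l + 1) * 2 ^ (l + 1 + 1) :=
          Nat.mul_le_mul hlt.le (by rw [pow_succ _ (l + 1)]; omega)
      _ = 2 ^ (2 * l + 3) := by rw [← pow_add]; congr 1; omega
      _ ≤ _ := Nat.pow_le_pow_right (by norm_num) (by omega)
  refine Nat.mul_le_mul hqp (Nat.le_sub_of_add_le (le_trans ?_ h))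
  rcases Nat.lt_or_ge m 2 with h2 | h2
  · obtain rfl : m = 1 := by omega
    simp only [Nat.reduceSub, Nat.zero_mul]
    nlinarith
  · obtain ⟨x, rfl⟩ := Nat.exists_eq_add_of_le' h2
    rw [Nat.add_sub_cancel]
    nlinarith

theorem bound_le (n m d : ℕ) : bound n m d ≤ 1200 * (n + m) * (d + 1) := by
  have h₁ : (0 : ℤ) ≤ (d + 1) * (3 - (min n 1 : ℕ)) := mul_nonneg (by positivity) (by omega)
  have h₂ : (0 : ℤ) ≤ n * d := by positivity
  have h₃ : (0 : ℤ) ≤ m * d := by positivity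
  rw [bound]
  nlinarith

theorem one_le_logb_add {n m : ℕ} (hm : 1 ≤ m) (h : 2 ≤ max n m) :
    1 ≤ Real.logb 2 n + Real.logb 2 m ∧
      Real.logb 2 (n + m : ℕ) ≤ 1 + (Real.logb 2 n + Real.logb 2 m) := by
  have hnn : ∀ k : ℕ, 0 ≤ Real.logb 2 k := fun k =>
    div_nonneg (Real.log_natCast_nonneg k) (Real.log_nonneg (by norm_num))
  have hone : ∀ k : ℕ, 2 ≤ k → 1 ≤ Real.logb 2 k := fun k hk => by
    rw [Real.le_logb_iff_rpow_le (by norm_num) (by positivity), Real.rpow_one]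
    exact_mod_cast hk
  refine ⟨?_, ?_⟩
  · rcases le_max_iff.1 h with h | h
    · linarith [hone n h, hnn m]
    · linarith [hone m h, hnn n]
  -- `Real.logb 2 0` is 0, as the convention demands; for n, m ≥ 1 the bound follows from n + m ≤
  -- 2nm.
  · rcases Nat.eq_zero_or_pos n with rfl | hn
    · simp
    · have hn' : (n : ℝ) ≠ 0 := by positivity
      have hm' : (m : ℝ) ≠ 0 := by positivity
      have h2 : (1 : ℝ) = Real.logb 2 2 := by simp
      rw [h2, ← Real.logb_mul hn' hm', ← Real.logb_mul (by norm_num) (by positivity)]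
      refine Real.logb_le_logb_of_le (by norm_num) (by positivity) ?_
      have : n + m ≤ 2 * (n * m) := by nlinarith
      exact_mod_cast this

end AndOr

theorem mainTheorem6 (ξ : ℚ) (hξ₁ : 19 / 10 ≤ ξ) (hξ₂ : ξ < 2) :
    ∃ C : ℝ, 0 < C ∧ ∀ n m : ℕ, 1 ≤ m → 2 ≤ max n m →
      AndOr.RunsWithin ξ n m (C * ((m + n : ℝ) * (Real.logb 2 n + Real.logb 2 m))) := by
  have hden : (0 : ℚ) < ξ.den := by exact_mod_cast ξ.den_pos
  have hnum : ((ξ.num.toNat : ℕ) : ℚ) = ξ * ξ.den := by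
    have h : (0 : ℤ) ≤ ξ.num := Rat.num_nonneg.2 (by linarith)
    rw [Rat.mul_den_eq_num]
    exact_mod_cast Int.toNat_of_nonneg h
  have hp : ξ.num.toNat ≤ 2 * ξ.den := by
    have : ((ξ.num.toNat : ℕ) : ℚ) ≤ 2 * ξ.den := by rw [hnum]; gcongr
    exact_mod_cast this
  have hq : ξ.den ≤ ξ.num.toNat := by
    have : (ξ.den : ℚ) ≤ (ξ.num.toNat : ℕ) := by rw [hnum]; nlinarith
    exact_mod_cast this
  -- 11700 = 1300 · 9: the linear costs raise 1200 to 1300, and with s = log₂ n + log₂ m ≥ 1 one has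
  -- 2(1 + s) + 5 ≤ 9s.
  refine ⟨11700, by norm_num, fun n m hm h => ?_⟩
  obtain ⟨out, G, t, h₁, h₂, -⟩ := AndOr.spec_andOrPath (d := 2 * Nat.log 2 (n + m) + 4) hp hm
    (by omega) (AndOr.leMu_of_log hq hm) #[] 0 rfl
  refine ⟨out, _, h₁, ?_⟩
  obtain ⟨h₃, h₄⟩ := AndOr.one_le_logb_add hm h
  have h₅ : (Nat.log 2 (n + m) : ℝ) ≤ Real.logb 2 (n + m : ℕ) := by
    have := Real.natLog_le_logb (n + m) 2
    exact_mod_cast this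
  have h₆ : (t : ℤ) ≤ 1300 * ((m + n) * (2 * Nat.log 2 (n + m) + 5)) := by
    have := AndOr.bound_le n m (2 * Nat.log 2 (n + m) + 4)
    have h₇ : (0 : ℤ) ≤ (n + m) * Nat.log 2 (n + m) := by positivity
    have h₈ : (1 : ℤ) ≤ m := by exact_mod_cast hm
    push_cast at h₂ this
    nlinarith
  have h₇ : (t : ℝ) ≤ 1300 * ((m + n) * (2 * Nat.log 2 (n + m) + 5)) := by exact_mod_cast h₆
  have h₈ : (2 * Nat.log 2 (n + m) + 5 : ℝ) ≤ 9 * (Real.logb 2 n + Real.logb 2 m) := by linarith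
  calc (t : ℝ) ≤ _ := h₇
    _ ≤ 1300 * ((m + n) * (9 * (Real.logb 2 n + Real.logb 2 m))) := by gcongr
    _ = _ := by ring
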